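/- Let $N\ge 1$, let $\Omega\subset\mathbb R^N$ be a bounded open set with Lipschitz boundary, and let $A:\mathbb R^N\to\mathbb R^N$ be measurable and locally bounded with $A\in C^2(\overline\Omega)$, i.e. $A$ is $C^2$ in $\Omega$, continuous on $\overline\Omega$, and its derivatives of order at most $2$ in $\Omega$ extend continuously to $\overline\Omega$. Let $u\in H^1_A(\Omega)$, i.e. $u\in L^2(\Omega,\mathbb C)$ has a weak gradient $\nabla u$ in $\Omega$ with $\nabla u-iAu\in L^2(\Omega,\mathbb C^N)$. Let $(\rho_n)_{n\in\mathbb N}$ be nonnegative radial functions in $L^1(\mathbb R^N)$, where $\rho_n(r)$ denotes the value of $\rho_n$ at the points with $|x|=r$, such that $$\lim_{n\to\infty}\int_0^\infty\rho_n(r)\,r^{N-1}\,dr=1\qquad\text{and}\qquad \lim_{n\to\infty}\int_\delta^\infty\rho_n(r)\,r^{N-1}\,dr=0\quad\text{for every }\delta>0 .$$ Then the double integrals below are finite for every $n$, and $$\lim_{n\to\infty}\int_\Omega\int_\Omega\frac{\bigl|u(x)-e^{i(x-y)\cdot A\left(\frac{x+y}2\right)}u(y)\bigr|^2}{|x-y|^2}\,\rho_n(x-y)\,dx\,dy=2K_N\int_\Omega|\nabla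 u-iA(x)u|^2\,dx,$$ where $$K_N=\frac12\int_{\mathbb S^{N-1}}|\omega\cdot\mathbf e|^2\,d\mathcal H^{N-1}(\omega)$$ for any unit vector $\mathbf e\in\mathbb R^N$ (the value does not depend on $\mathbf e$). -/

import Mathlib

open MeasureTheory Set Filter Topology
open scoped ContDiff

namespace MagneticBBM

/-- Euclidean space of dimension `N`. -/
abbrev Rn (N : ℕ) : Type := EuclideanSpace ℝ (Fin N)

/-- `Ω` has Lipschitz boundary: near each boundary point it is, in a suitable direction `e`, the
region strictly above the graph of a Lipschitz function of the component orthogonal to `e`. -/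
def HasLipschitzBoundary {N : ℕ} (Ω : Set (Rn N)) : Prop :=
  ∀ x₀ ∈ frontier Ω, ∃ (e : Rn N) (r : ℝ) (K : NNReal) (γ : Rn N → ℝ),
    ‖e‖ = 1 ∧ 0 < r ∧ LipschitzWith K γ ∧
      ∀ x ∈ Metric.ball x₀ r, (x ∈ Ω ↔ γ (x - inner ℝ e x • e) < inner ℝ e x)

/-- `A ∈ C²(Ω̄)`: `A` is `C²` in the open set `Ω` and continuous on `Ω̄`, and each of its
derivatives of order at most two in `Ω` extends continuously to `Ω̄`. -/
def IsC2UpToBoundary {N : ℕ} (A : Rn N → Rn N) (Ω : Set (Rn N)) : Prop :=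
  ContDiffOn ℝ 2 A Ω ∧ ContinuousOn A (closure Ω) ∧
    ∀ k : ℕ, k ≤ 2 → ∃ D : Rn N → ContinuousMultilinearMap ℝ (fun _ : Fin k => Rn N) (Rn N),
      ContinuousOn D (closure Ω) ∧ EqOn D (iteratedFDeriv ℝ k A) Ω

/-- `A` is bounded in a neighbourhood of every point. -/
def IsLocallyBounded {N : ℕ} (A : Rn N → Rn N) : Prop :=
  ∀ x : Rn N, ∃ C : ℝ, ∀ᶠ y in 𝓝 x, ‖A y‖ ≤ C

/-- `G` is the weak (distributional) gradient of the complex-valued function `u` in `Ω`. -/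
def IsWeakGradient {N : ℕ} (Ω : Set (Rn N)) (u : Rn N → ℂ)
    (G : Rn N → EuclideanSpace ℂ (Fin N)) : Prop :=
  LocallyIntegrableOn u Ω volume ∧ LocallyIntegrableOn G Ω volume ∧
    ∀ φ : Rn N → ℝ, ContDiff ℝ ∞ φ → HasCompactSupport φ → tsupport φ ⊆ Ω →
      ∀ i : Fin N,
        ∫ x in Ω, u x * (fderiv ℝ φ x (EuclideanSpace.single i 1) : ℂ)
          = -∫ x in Ω, G x i * (φ x : ℂ)

/-- The vector field `∇u - iAu`, where `G = ∇u`. -/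
noncomputable def magneticGradient {N : ℕ} (A : Rn N → Rn N) (u : Rn N → ℂ)
    (G : Rn N → EuclideanSpace ℂ (Fin N)) (x : Rn N) : EuclideanSpace ℂ (Fin N) :=
  WithLp.toLp 2 fun j => G x j - Complex.I * (A x j : ℂ) * u x

/-- `u ∈ H¹_A(Ω)`: `u ∈ L²(Ω, ℂ)` and `∇u - iAu ∈ L²(Ω)`. -/
def MemMagneticH1 {N : ℕ} (A : Rn N → Rn N) (Ω : Set (Rn N)) (u : Rn N → ℂ) : Prop :=
  MemLp u 2 (volume.restrict Ω) ∧
    ∃ G : Rn N → EuclideanSpace ℂ (Fin N), IsWeakGradient Ω u G ∧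
      MemLp (magneticGradient A u G) 2 (volume.restrict Ω)

/-- `|u(x) - exp(i (x-y)·A((x+y)/2)) u(y)|² / |x-y|² · ρ(|x-y|)`. -/
noncomputable def magneticIntegrand {N : ℕ} (A : Rn N → Rn N) (u : Rn N → ℂ) (ρ : ℝ → ℝ)
    (x y : Rn N) : ℝ :=
  ‖u x - Complex.exp (Complex.I * (inner ℝ (x - y) (A ((1 / 2 : ℝ) • (x + y))) : ℝ)) * u y‖ ^ 2
    / ‖x - y‖ ^ 2 * ρ ‖x - y‖

/-- `K_N = ½ ∫_{S^{N-1}} |ω·e|² dH^{N-1}(ω)`, computed with the vector `e`; `volume.toSphere` is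
the surface measure of the unit sphere. -/
noncomputable def bbmConstant {N : ℕ} (e : Rn N) : ℝ :=
  1 / 2 * ∫ w : Metric.sphere (0 : Rn N) 1,
    |inner ℝ (w : Rn N) e| ^ 2 ∂(volume : Measure (Rn N)).toSphere

end MagneticBBM

namespace MagneticBBM

/-! Put `h = y - x`. The double integral becomes `∫ ρ_n(|h|) I(h) dh`, where `I(h)` is the squared
`L²` norm in `x` of the magnetic difference quotient over those `x` with `x, x + h ∈ Ω`. With `W =
∇u - iAu` and `J(h) = ∫ |W(x) · h/|h||² dx`, two facts suffice.

The first is `I(h) - J(h) → 0` as `h → 0`. It follows from the `L²` convergence of the difference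
quotient plus `W · h/|h|` to zero (`tendsto_eLpNorm_diffQuot_add`). Since `I - J` is also bounded,
the radial kernels annihilate it (`tendsto_integral_radial_mul`).

The second is that `J` depends only on the direction of `h`. In polar coordinates `∫ ρ_n(|h|) J(h)
dh` is therefore exactly the radial mass, which tends to `1`, times the spherical integral of `J`.
Rotational invariance of second moments evaluates the latter as `2 K_N ∫ |W|²`
(`integral_sphere_energy`).

For the `L²` convergence, `x` is sorted by whether the segment from `x` to `x + h` stays in `Ω`. If
it does, `u(x + h) - u(x)` is the integral of `∇u · h` along the segment, and continuity of
translations in `L²` together with a Taylor expansion of the phase give the claim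
(`tendsto_eLpNorm_good`). If it does not, `x` is within `|h|` of the complement of `Ω`. The
Lipschitz graph condition then joins `x` to `x + h` by a three-segment path of length `O(|h|)`
inside a boundary strip of width `O(|h|)` (`exists_finite_directions`), so the difference quotient
is controlled by `∇u` and `u` on strips that shrink to nothing (`tendsto_eLpNorm_diffQuot_leaving`).
These paths replace a Sobolev extension operator: `u` and `∇u` are merely extended by zero. -/

/-! ### The bilinear pairing of complex and real vectors -/

/-- The complex-bilinear pairing `z · v` of a complex vector with a real vector. -/
noncomputable def cdot {N : ℕ} (z : EuclideanSpace ℂ (Fin N)) (v : Rn N) : ℂ :=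
  ∑ i, z i * (v i : ℂ)

theorem norm_cdot_le {N : ℕ} (z : EuclideanSpace ℂ (Fin N)) (v : Rn N) :
    ‖cdot z v‖ ≤ ‖z‖ * ‖v‖ := by
  have h := norm_inner_le_norm (𝕜 := ℂ)
    (WithLp.toLp 2 (fun i => (v i : ℂ)) : EuclideanSpace ℂ (Fin N)) z
  have h1 : ‖(WithLp.toLp 2 (fun i => (v i : ℂ)) : EuclideanSpace ℂ (Fin N))‖ = ‖v‖ := by
    simp [EuclideanSpace.norm_eq]
  have h2 : inner ℂ (WithLp.toLp 2 (fun i => (v i : ℂ)) : EuclideanSpace ℂ (Fin N)) z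
      = cdot z v := by
    simp [PiLp.inner_apply, cdot]
  rw [h1, h2, mul_comm] at h
  exact h

theorem cdot_sub {N : ℕ} (z w : EuclideanSpace ℂ (Fin N)) (v : Rn N) :
    cdot (z - w) v = cdot z v - cdot w v := by
  simp [cdot, sub_mul, Finset.sum_sub_distrib]

theorem cdot_smul {N : ℕ} (z : EuclideanSpace ℂ (Fin N)) (c : ℝ) (v : Rn N) :
    cdot z (c • v) = c * cdot z v := by
  simp only [cdot, PiLp.smul_apply, smul_eq_mul, Complex.ofReal_mul, Finset.mul_sum]
  exact Finset.sum_congr rfl fun i _ => by ring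

theorem cdot_zero_left {N : ℕ} (v : Rn N) : cdot (0 : EuclideanSpace ℂ (Fin N)) v = 0 := by
  simp [cdot]

@[fun_prop]
theorem continuous_cdot {N : ℕ} :
    Continuous fun p : EuclideanSpace ℂ (Fin N) × Rn N => cdot p.1 p.2 := by
  unfold cdot
  fun_prop

theorem cdot_magneticGradient {N : ℕ} (A : Rn N → Rn N) (u : Rn N → ℂ)
    (G : Rn N → EuclideanSpace ℂ (Fin N)) (x v : Rn N) :
    cdot (magneticGradient A u G x) v
      = cdot (G x) v - Complex.I * (inner ℝ v (A x) : ℝ) * u x := by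
  simp only [cdot, magneticGradient, PiLp.inner_apply, sub_mul, Finset.sum_sub_distrib,
    RCLike.inner_apply, conj_trivial, Complex.ofReal_sum, Complex.ofReal_mul, Finset.mul_sum,
    Finset.sum_mul]
  congr 1
  exact Finset.sum_congr rfl fun i _ => by ring

/-! ### Tools for `L²` norms -/

/-- Translations are continuous in `L²`. -/
theorem tendsto_eLpNorm_translate_sub {N : ℕ} {F : Type*} [NormedAddCommGroup F]
    {f : Rn N → F} (hf : MemLp f 2 volume) :
    Tendsto (fun h : Rn N => eLpNorm (fun x => f (x + h) - f x) 2 volume) (𝓝 0) (𝓝 0) := by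
  have : Fact ((2 : ENNReal) ≠ ⊤) := ⟨by simp⟩
  have hm : ∀ h : Rn N, MeasurePreserving (fun x : Rn N => x + h) volume volume :=
    fun h => measurePreserving_add_right volume h
  have key : Tendsto (fun h : Rn N => Lp.compMeasurePreserving (fun x : Rn N => x + h) (hm h)
      (hf.toLp f)) (𝓝 0) (𝓝 (Lp.compMeasurePreserving (fun x : Rn N => x + 0) (hm 0)
      (hf.toLp f))) := by
    let g : C(Rn N, C(Rn N, Rn N)) :=
      (ContinuousMap.mk (fun a : Rn N × Rn N => a.2 + a.1) (by fun_prop)).curry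
    have := (continuous_const (y := hf.toLp f)).compMeasurePreservingLp g.continuous
      (fun h => hm h) (by simp)
    exact this.tendsto 0
  rw [tendsto_iff_edist_tendsto_0] at key
  refine key.congr fun h => ?_
  rw [Lp.toLp_compMeasurePreserving hf, Lp.toLp_compMeasurePreserving hf, Lp.edist_toLp_toLp]
  congr 1
  ext x
  simp

/-- Minkowski's integral inequality in `L²` for integrals over the unit interval. -/
theorem eLpNorm_two_integral_le {X : Type*} [MeasurableSpace X] {μ : Measure X} [SFinite μ]
    {k : X → ℝ → ℂ}
    (hk : AEStronglyMeasurable (Function.uncurry k) (μ.prod (volume.restrict (Icc (0 : ℝ) 1))))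
    {C : ENNReal} (hC : ∀ s ∈ Icc (0 : ℝ) 1, eLpNorm (fun x => k x s) 2 μ ≤ C) :
    eLpNorm (fun x => ∫ s in Icc (0 : ℝ) 1, k x s) 2 μ ≤ C := by
  have hp : IsProbabilityMeasure (volume.restrict (Icc (0 : ℝ) 1)) := ⟨by simp⟩
  have sq : ∀ f : X → ℂ, eLpNorm f 2 μ = (∫⁻ x, ‖f x‖ₑ ^ (2 : ℝ) ∂μ) ^ (1 / 2 : ℝ) := by
    intro f
    rw [eLpNorm_eq_lintegral_rpow_enorm_toReal (by simp) (by simp)]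
    simp
  have sq' : ∀ f : X → ℂ, eLpNorm f 2 μ ≤ C ↔ ∫⁻ x, ‖f x‖ₑ ^ (2 : ℝ) ∂μ ≤ C ^ (2 : ℝ) := by
    intro f
    rw [sq, one_div, ENNReal.rpow_inv_le_iff (by norm_num)]
  rw [sq']
  calc ∫⁻ x, ‖∫ s in Icc (0 : ℝ) 1, k x s‖ₑ ^ (2 : ℝ) ∂μ
      ≤ ∫⁻ x, (∫⁻ s in Icc (0 : ℝ) 1, ‖k x s‖ₑ ^ (2 : ℝ)) ∂μ := by
        refine lintegral_mono_ae ?_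
        filter_upwards [hk.prodMk_left] with x hx
        -- The unit interval has mass one, so the `L¹` norm in `s` is at most the `L²` norm; Tonelli
        -- then finishes the estimate.
        have h1 := eLpNorm_le_eLpNorm_of_exponent_le (p := 1) (q := 2) (by norm_num) hx
        have e2 : eLpNorm (fun s => Function.uncurry k (x, s)) 2
            (volume.restrict (Icc (0 : ℝ) 1))
            = (∫⁻ s in Icc (0 : ℝ) 1, ‖k x s‖ₑ ^ (2 : ℝ)) ^ (1 / 2 : ℝ) := by
          rw [eLpNorm_eq_lintegral_rpow_enorm_toReal (by simp) (by simp)]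
          simp
        rw [eLpNorm_one_eq_lintegral_enorm, e2, one_div,
          ENNReal.le_rpow_inv_iff (by norm_num)] at h1
        refine le_trans ?_ h1
        gcongr
        exact enorm_integral_le_lintegral_enorm _
    _ = ∫⁻ s in Icc (0 : ℝ) 1, ∫⁻ x, ‖k x s‖ₑ ^ (2 : ℝ) ∂μ := by
        apply lintegral_lintegral_swap
        exact hk.enorm.pow_const _
    _ ≤ ∫⁻ s in Icc (0 : ℝ) 1, C ^ (2 : ℝ) := by
        refine setLIntegral_mono measurable_const fun s hs => ?_
        exact (sq' _).1 (hC s hs)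
    _ = C ^ (2 : ℝ) := by simp

/-- The square integral in terms of the `L²` seminorm. -/
theorem integral_norm_sq_eq {X F : Type*} [MeasurableSpace X] [NormedAddCommGroup F]
    {μ : Measure X} {f : X → F} (hf : MemLp f 2 μ) :
    ∫ x, ‖f x‖ ^ 2 ∂μ = (eLpNorm f 2 μ).toReal ^ 2 := by
  have h := hf.eLpNorm_eq_integral_rpow_norm (by simp) (by simp)
  have h0 : 0 ≤ ∫ x, ‖f x‖ ^ 2 ∂μ := integral_nonneg fun x => by positivity
  rw [h, ENNReal.toReal_ofReal (by positivity)]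
  simp only [ENNReal.toReal_ofNat, Real.rpow_ofNat]
  rw [← Real.rpow_natCast, ← Real.rpow_mul h0]
  simp

/-! ### Integration in polar coordinates -/

/-- The origin is a null set because `N ≥ 1`, and off it the volume is the product of the sphere
measure and `r ^ (N - 1) dr`. No integrability is needed, since `integral_prod_mul` holds
unconditionally. -/
theorem integral_norm_mul_direction {N : ℕ} (hN : 1 ≤ N) (φ : ℝ → ℝ) (f : Rn N → ℝ) :
    ∫ x : Rn N, φ ‖x‖ * f (‖x‖⁻¹ • x)
      = (∫ r in Ioi (0 : ℝ), φ r * r ^ (N - 1)) *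
        ∫ w : Metric.sphere (0 : Rn N) 1, f w ∂(volume : Measure (Rn N)).toSphere := by
  have : Nontrivial (Rn N) := by
    have : Nonempty (Fin N) := ⟨⟨0, hN⟩⟩
    infer_instance
  calc ∫ x : Rn N, φ ‖x‖ * f (‖x‖⁻¹ • x)
      = ∫ x : ({(0)}ᶜ : Set (Rn N)), φ ‖x.1‖ * f (‖x.1‖⁻¹ • x.1)
          ∂((volume : Measure (Rn N)).comap (↑)) := by
        rw [integral_subtype_comap (measurableSet_singleton _).compl
          fun x : Rn N => φ ‖x‖ * f (‖x‖⁻¹ • x), restrict_compl_singleton]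
    _ = ∫ p, f p.1 * φ p.2
          ∂(volume : Measure (Rn N)).toSphere.prod (.volumeIoiPow (N - 1)) := by
        have h := (volume : Measure (Rn N)).measurePreserving_homeomorphUnitSphereProd.integral_comp
          (Homeomorph.measurableEmbedding _) (fun p => f p.1 * φ p.2)
        rw [finrank_euclideanSpace_fin] at h
        rw [← h]
        refine integral_congr_ae (.of_forall fun x => ?_)
        simp [mul_comm]
    _ = (∫ w : Metric.sphere (0 : Rn N) 1, f w ∂(volume : Measure (Rn N)).toSphere) *
          ∫ r : Ioi (0 : ℝ), φ r ∂.volumeIoiPow (N - 1) :=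
        integral_prod_mul (fun w : Metric.sphere (0 : Rn N) 1 => f w)
          (fun r : Ioi (0 : ℝ) => φ r)
    _ = _ := by
        rw [mul_comm]
        congr 1
        simp only [Measure.volumeIoiPow, ENNReal.ofReal]
        rw [integral_withDensity_eq_integral_smul,
          integral_subtype_comap measurableSet_Ioi fun a => Real.toNNReal (a ^ (N - 1)) • φ a,
          setIntegral_congr_fun measurableSet_Ioi fun x hx => ?_]
        · simp only [NNReal.smul_def]
          rw [Real.coe_toNNReal _ (pow_nonneg (mem_Ioi.1 hx).le _), smul_eq_mul, mul_comm]
        · exact (measurable_subtype_coe.pow_const _).real_toNNReal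

/-- The second moment of the sphere in a direction `v` depends only on `‖v‖`. -/
theorem integral_sphere_inner_sq {N : ℕ} (hN : 1 ≤ N) {e : Rn N} (he : ‖e‖ = 1) (v : Rn N) :
    ∫ w : Metric.sphere (0 : Rn N) 1, (inner ℝ (w : Rn N) v) ^ 2
        ∂(volume : Measure (Rn N)).toSphere
      = ‖v‖ ^ 2 * ∫ w : Metric.sphere (0 : Rn N) 1, (inner ℝ (w : Rn N) e) ^ 2
        ∂(volume : Measure (Rn N)).toSphere := by
  set ve : Rn N := ‖v‖ • e with hve
  have hnorm : ‖v‖ = ‖ve‖ := by simp [hve, norm_smul, he]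
  -- This reflection is a linear isometry carrying `v` to `‖v‖ • e`. Its invariance is known for
  -- volume, so the sphere integrals are compared through integrals over the unit ball, whose radial
  -- factor `∫₀¹ r ^ (N - 1) dr` is nonzero and cancels.
  set R := Submodule.reflection (Submodule.span ℝ {v - ve})ᗮ with hR
  have hRv : R v = ve := Submodule.reflection_sub hnorm
  set φ : ℝ → ℝ := (Iio 1).indicator fun _ => (1 : ℝ)
  have h1 := integral_norm_mul_direction hN φ fun w => (inner ℝ w v) ^ 2
  have h2 := integral_norm_mul_direction hN φ fun w => (inner ℝ w ve) ^ 2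
  have h3 : ∫ x : Rn N, φ ‖x‖ * (inner ℝ (‖x‖⁻¹ • x) v) ^ 2
      = ∫ x : Rn N, φ ‖x‖ * (inner ℝ (‖x‖⁻¹ • x) ve) ^ 2 := by
    rw [← R.measurePreserving.integral_comp R.toHomeomorph.measurableEmbedding
      fun x : Rn N => φ ‖x‖ * (inner ℝ (‖x‖⁻¹ • x) ve) ^ 2]
    refine integral_congr_ae (.of_forall fun x => ?_)
    simp only [LinearIsometryEquiv.norm_map]
    rw [← hRv, ← map_smul, LinearIsometryEquiv.inner_map_map]
  have hpos : (∫ r in Ioi (0 : ℝ), φ r * r ^ (N - 1)) ≠ 0 := by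
    have : ∀ r : ℝ, φ r * r ^ (N - 1) = (Iio 1).indicator (fun r => r ^ (N - 1)) r := by
      intro r
      by_cases hr : r ∈ Iio (1 : ℝ) <;> simp [φ, hr]
    simp_rw [this]
    rw [setIntegral_indicator measurableSet_Iio, Ioi_inter_Iio, ← integral_Ioc_eq_integral_Ioo,
      ← intervalIntegral.integral_of_le zero_le_one, integral_pow]
    have : (0 : ℝ) < (N - 1 : ℕ) + 1 := by positivity
    simp only [one_pow, ne_eq, Nat.add_eq_zero_iff, one_ne_zero, and_false, not_false_eq_true,
      zero_pow, sub_zero]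
    positivity
  have h4 := mul_left_cancel₀ hpos (h1.symm.trans (h3.trans h2))
  rw [h4, ← integral_const_mul]
  refine integral_congr_ae (.of_forall fun x => ?_)
  simp [hve, inner_smul_right, mul_pow]

theorem two_mul_bbmConstant {N : ℕ} (e : Rn N) :
    2 * bbmConstant e = ∫ w : Metric.sphere (0 : Rn N) 1, (inner ℝ (w : Rn N) e) ^ 2
        ∂(volume : Measure (Rn N)).toSphere := by
  simp [bbmConstant]

/-- Splitting `z` into real and imaginary parts reduces the complex spherical average to two real
second moments. -/
theorem norm_cdot_sq {N : ℕ} (z : EuclideanSpace ℂ (Fin N)) (v : Rn N) :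
    ‖cdot z v‖ ^ 2 = (inner ℝ v (WithLp.toLp 2 fun i => (z i).re : Rn N)) ^ 2
      + (inner ℝ v (WithLp.toLp 2 fun i => (z i).im : Rn N)) ^ 2 := by
  rw [← Complex.normSq_eq_norm_sq, Complex.normSq_apply]
  simp [cdot, PiLp.inner_apply, sq]

theorem integral_sphere_cdot_sq {N : ℕ} (hN : 1 ≤ N) {e : Rn N} (he : ‖e‖ = 1)
    (z : EuclideanSpace ℂ (Fin N)) :
    ∫ w : Metric.sphere (0 : Rn N) 1, ‖cdot z (w : Rn N)‖ ^ 2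
        ∂(volume : Measure (Rn N)).toSphere
      = 2 * bbmConstant e * ‖z‖ ^ 2 := by
  have hi : ∀ v : Rn N, Integrable (fun w : Metric.sphere (0 : Rn N) 1 =>
      (inner ℝ (w : Rn N) v) ^ 2) (volume : Measure (Rn N)).toSphere := fun v =>
    Continuous.integrable_of_hasCompactSupport (by fun_prop) (HasCompactSupport.of_compactSpace _)
  simp_rw [norm_cdot_sq]
  rw [integral_add (hi _) (hi _), integral_sphere_inner_sq hN he,
    integral_sphere_inner_sq hN he (WithLp.toLp 2 fun i => (z i).im : Rn N), two_mul_bbmConstant,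
    ← add_mul, mul_comm]
  congr 1
  simp only [EuclideanSpace.norm_sq_eq, ← Finset.sum_add_distrib]
  refine Finset.sum_congr rfl fun i _ => ?_
  rw [← Complex.normSq_eq_norm_sq, Complex.normSq_apply]
  simp [sq]

/-! ### Segments inside a domain and the fundamental theorem of calculus -/

/-- The points `x` for which the whole segment from `x` to `x + v` lies in `Ω`. -/
def segDomain {N : ℕ} (Ω : Set (Rn N)) (v : Rn N) : Set (Rn N) :=
  {x | ∀ s ∈ Icc (0 : ℝ) 1, x + s • v ∈ Ω}

/-- Compactness of the parameter interval makes the neighbourhoods uniform in `s`. -/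
theorem isOpen_segDomain {N : ℕ} {Ω : Set (Rn N)} (hΩ : IsOpen Ω) (v : Rn N) :
    IsOpen (segDomain Ω v) := by
  rw [isOpen_iff_eventually]
  intro x hx
  refine isCompact_Icc.eventually_forall_of_forall_eventually fun s hs => ?_
  have hc : Continuous fun p : Rn N × ℝ => p.1 + p.2 • v := by fun_prop
  exact hc.continuousAt.eventually (hΩ.mem_nhds (hx s hs))

theorem segDomain_subset {N : ℕ} (Ω : Set (Rn N)) (v : Rn N) : segDomain Ω v ⊆ Ω := fun x hx => by
  simpa using hx 0 (by simp)

theorem add_mem_of_mem_segDomain {N : ℕ} {Ω : Set (Rn N)} {v x : Rn N}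
    (hx : x ∈ segDomain Ω v) : x + v ∈ Ω := by
  simpa using hx 1 (by simp)

/-- The weak gradient identity for functions that are extended by zero outside `Ω`, tested with
the derivatives in arbitrary directions. -/
def IsExtendedWeakGradient {N : ℕ} (Ω : Set (Rn N)) (u : Rn N → ℂ)
    (g : Rn N → EuclideanSpace ℂ (Fin N)) : Prop :=
  ∀ φ : Rn N → ℝ, ContDiff ℝ ∞ φ → HasCompactSupport φ → tsupport φ ⊆ Ω → ∀ v : Rn N,
    ∫ x, u x * (fderiv ℝ φ x v : ℂ) = -∫ x, cdot (g x) v * (φ x : ℂ)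

/-- All slices at fixed `s` are translates of one integrable function and have the same `L¹` norm;
this justifies the later uses of Fubini. -/
theorem integrable_cdot_segment {N : ℕ} {g : Rn N → EuclideanSpace ℂ (Fin N)}
    (hgm : StronglyMeasurable g) (hg : Integrable g volume) (v : Rn N) :
    Integrable (fun p : Rn N × ℝ => cdot (g (p.1 + p.2 • v)) v)
      ((volume : Measure (Rn N)).prod (volume.restrict (Icc (0 : ℝ) 1))) := by
  have hgv : Integrable (fun x => cdot (g x) v) volume := by
    refine (hg.norm.mul_const ‖v‖).mono' ?_ (.of_forall fun x => norm_cdot_le _ _)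
    exact (continuous_cdot.comp (Continuous.prodMk_left v)).comp_aestronglyMeasurable
      hgm.aestronglyMeasurable
  have hm : StronglyMeasurable fun p : Rn N × ℝ => cdot (g (p.1 + p.2 • v)) v :=
    (continuous_cdot.comp (Continuous.prodMk_left v)).comp_stronglyMeasurable
      (hgm.comp_measurable (by fun_prop))
  rw [integrable_prod_iff' hm.aestronglyMeasurable]
  refine ⟨.of_forall fun s => hgv.comp_add_right (s • v), ?_⟩
  have : ∀ s : ℝ, ∫ x, ‖cdot (g (x + s • v)) v‖ = ∫ x, ‖cdot (g x) v‖ := fun s =>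
    integral_add_right_eq_self (fun x => ‖cdot (g x) v‖) (s • v)
  simp only [this]
  exact integrable_const _

/-- The fundamental theorem of calculus is applied to the smooth `φ` and passed to `u` by duality.
Each translate `φ(· - s • v)` is an admissible test function exactly because the support of `φ` lies
in `segDomain Ω v`. -/
theorem integral_mul_sub_translate {N : ℕ} {Ω : Set (Rn N)}
    {u : Rn N → ℂ} {g : Rn N → EuclideanSpace ℂ (Fin N)}
    (hu : Integrable u volume) (hgm : StronglyMeasurable g) (hg : Integrable g volume)
    (hw : IsExtendedWeakGradient Ω u g) (v : Rn N)
    {φ : Rn N → ℝ} (hφ : ContDiff ℝ ∞ φ) (hφc : HasCompactSupport φ)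
    (hφs : tsupport φ ⊆ segDomain Ω v) :
    ∫ y, u y * ((φ (y - v) - φ y : ℝ) : ℂ)
      = ∫ x, (∫ s in Icc (0 : ℝ) 1, cdot (g (x + s • v)) v) * (φ x : ℂ) := by
  have hd : Continuous (fderiv ℝ φ) := hφ.continuous_fderiv (by simp)
  obtain ⟨C, hC⟩ := (hφc.fderiv (𝕜 := ℝ)).exists_bound_of_continuous hd
  obtain ⟨C', hC'⟩ := hφc.exists_bound_of_continuous hφ.continuous
  have ftc : ∀ y, φ (y - v) - φ y = -∫ s in Icc (0 : ℝ) 1, fderiv ℝ φ (y - s • v) v := by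
    intro y
    have h1 : ∀ s : ℝ, HasDerivAt (fun s : ℝ => φ (y - s • v)) (-(fderiv ℝ φ (y - s • v) v)) s := by
      intro s
      have hs : HasDerivAt (fun s : ℝ => y - s • v) (-v) s := by
        simpa using ((hasDerivAt_id s).smul_const v).const_sub y
      have := ((hφ.differentiable (by simp)).differentiableAt (x := y - s • v)).hasFDerivAt
        |>.comp_hasDerivAt s hs
      simpa [Function.comp_def] using this
    have h2 := intervalIntegral.integral_eq_sub_of_hasDerivAt (a := 0) (b := 1)
      (fun s _ => h1 s) (Continuous.intervalIntegrable (by fun_prop) _ _)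
    rw [intervalIntegral.integral_of_le zero_le_one, ← integral_Icc_eq_integral_Ioc,
      integral_neg] at h2
    simpa using h2.symm
  have hI1 : Integrable (fun p : Rn N × ℝ => u p.1 * (fderiv ℝ φ (p.1 - p.2 • v) v : ℂ))
      ((volume : Measure (Rn N)).prod (volume.restrict (Icc (0 : ℝ) 1))) := by
    refine (hu.comp_fst _).mul_bdd (c := C * ‖v‖) ?_ (.of_forall fun p => ?_)
    · exact Continuous.aestronglyMeasurable (by fun_prop)
    · rw [Complex.norm_real]
      exact (ContinuousLinearMap.le_opNorm _ _).trans (by gcongr; exact hC _)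
  have hI2 : Integrable (fun p : Rn N × ℝ => cdot (g (p.1 + p.2 • v)) v * (φ p.1 : ℂ))
      ((volume : Measure (Rn N)).prod (volume.restrict (Icc (0 : ℝ) 1))) := by
    refine (integrable_cdot_segment hgm hg v).mul_bdd (c := C') ?_ (.of_forall fun p => ?_)
    · have := hφ.continuous
      exact Continuous.aestronglyMeasurable (by fun_prop)
    · rw [Complex.norm_real]
      exact hC' _
  have hslice : ∀ s ∈ Icc (0 : ℝ) 1, ∫ y, u y * (fderiv ℝ φ (y - s • v) v : ℂ)
      = -∫ x, cdot (g (x + s • v)) v * (φ x : ℂ) := by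
    intro s hs
    have hsupp : tsupport (fun y => φ (y - s • v)) = (fun y => y - s • v) ⁻¹' tsupport φ := by
      exact tsupport_comp_eq_preimage φ (Homeomorph.subRight (s • v))
    have h1 := hw (fun y => φ (y - s • v)) (hφ.comp (contDiff_id.sub contDiff_const))
      (hφc.comp_homeomorph (Homeomorph.subRight (s • v))) (by
        rw [hsupp]
        intro y hy
        simpa using hφs hy s hs) v
    simp only [fderiv_comp_sub] at h1
    rw [h1, ← integral_add_right_eq_self (fun x => cdot (g x) v * (φ (x - s • v) : ℂ)) (s • v)]
    simp
  calc ∫ y, u y * ((φ (y - v) - φ y : ℝ) : ℂ)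
      = -∫ y, ∫ s in Icc (0 : ℝ) 1, u y * (fderiv ℝ φ (y - s • v) v : ℂ) := by
        rw [← integral_neg]
        refine integral_congr_ae (.of_forall fun y => ?_)
        simp only [ftc, integral_const_mul, integral_complex_ofReal, Complex.ofReal_neg, mul_neg]
    _ = -∫ s in Icc (0 : ℝ) 1, ∫ y, u y * (fderiv ℝ φ (y - s • v) v : ℂ) := by
        rw [integral_integral_swap hI1]
    _ = ∫ s in Icc (0 : ℝ) 1, ∫ x, cdot (g (x + s • v)) v * (φ x : ℂ) := by
        rw [setIntegral_congr_fun measurableSet_Icc hslice, integral_neg, neg_neg]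
    _ = _ := by
        rw [← integral_integral_swap hI2]
        simp only [integral_mul_const]

/-- The fundamental theorem of calculus for functions with a weak gradient. -/
theorem ae_sub_eq_integral_segment {N : ℕ} {Ω : Set (Rn N)} (hΩ : IsOpen Ω)
    {u : Rn N → ℂ} {g : Rn N → EuclideanSpace ℂ (Fin N)}
    (hu : Integrable u volume) (hgm : StronglyMeasurable g) (hg : Integrable g volume)
    (hw : IsExtendedWeakGradient Ω u g) (v : Rn N) :
    ∀ᵐ x, x ∈ segDomain Ω v →
      u (x + v) - u x = ∫ s in Icc (0 : ℝ) 1, cdot (g (x + s • v)) v := by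
  have hK : Integrable (fun x => ∫ s in Icc (0 : ℝ) 1, cdot (g (x + s • v)) v) volume :=
    (integrable_cdot_segment hgm hg v).integral_prod_left
  have huv := hu.comp_add_right v
  have hf : Integrable
      (fun x => u (x + v) - u x - ∫ s in Icc (0 : ℝ) 1, cdot (g (x + s • v)) v) volume :=
    (huv.sub hu).sub hK
  -- By the fundamental lemma of the calculus of variations it is enough to test on the open set
  -- `segDomain Ω v`.
  have h := (isOpen_segDomain hΩ v).ae_eq_zero_of_integral_contDiff_smul_eq_zero
    (hf.locallyIntegrable.locallyIntegrableOn _) ?_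
  · filter_upwards [h] with x hx hx'
    exact sub_eq_zero.1 (hx hx')
  intro φ hφ hφc hφs
  obtain ⟨C', hC'⟩ := hφc.exists_bound_of_continuous hφ.continuous
  have hmul : ∀ {f : Rn N → ℂ}, Integrable f volume →
      Integrable (fun x => f x * (φ x : ℂ)) volume := by
    intro f hf
    refine hf.mul_bdd (c := C') ?_ (.of_forall fun p => ?_)
    · have := hφ.continuous
      exact Continuous.aestronglyMeasurable (by fun_prop)
    · rw [Complex.norm_real]
      exact hC' _
  have key := integral_mul_sub_translate hu hgm hg hw v hφ hφc hφs
  have e1 : ∫ y, u y * ((φ (y - v) - φ y : ℝ) : ℂ)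
      = (∫ x, u (x + v) * (φ x : ℂ)) - ∫ x, u x * (φ x : ℂ) := by
    have e2 : ∫ x, u (x + v) * (φ x : ℂ) = ∫ y, u y * (φ (y - v) : ℂ) := by
      rw [← integral_add_right_eq_self (fun y => u y * (φ (y - v) : ℂ)) v]
      simp
    have hi : Integrable (fun y => u y * (φ (y - v) : ℂ)) volume := by
      simpa using (hmul huv).comp_sub_right v
    rw [e2, ← integral_sub hi (hmul hu)]
    simp only [Complex.ofReal_sub, mul_sub]
  calc ∫ x, φ x • (u (x + v) - u x - ∫ s in Icc (0 : ℝ) 1, cdot (g (x + s • v)) v)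
      = ∫ x, (u (x + v) * (φ x : ℂ) - u x * (φ x : ℂ)
          - (∫ s in Icc (0 : ℝ) 1, cdot (g (x + s • v)) v) * (φ x : ℂ)) := by
        refine integral_congr_ae (.of_forall fun x => ?_)
        simp only [Complex.real_smul]
        ring
    _ = 0 := by
        have hd : Integrable (fun x => u (x + v) * (φ x : ℂ) - u x * (φ x : ℂ)) volume :=
          (hmul huv).sub (hmul hu)
        rw [integral_sub hd (hmul hK), integral_sub (hmul huv) (hmul hu), ← e1, key, sub_self]

/-- Translates of a function with a square integrable weak gradient: the difference quotient on
`E` is controlled by the gradient near the segments issuing from `E`. -/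
theorem eLpNorm_indicator_translate_sub_le {N : ℕ} {Ω : Set (Rn N)} (hΩ : IsOpen Ω)
    {u : Rn N → ℂ} {g : Rn N → EuclideanSpace ℂ (Fin N)}
    (hu : Integrable u volume) (hgm : StronglyMeasurable g) (hg : Integrable g volume)
    (hw : IsExtendedWeakGradient Ω u g) (v : Rn N)
    {E F : Set (Rn N)} (hE : MeasurableSet E) (hF : MeasurableSet F)
    (hEv : E ⊆ segDomain Ω v) (hEF : E ⊆ segDomain F v) :
    eLpNorm (E.indicator fun x => u (x + v) - u x) 2 volume
      ≤ ENNReal.ofReal ‖v‖ * eLpNorm (F.indicator g) 2 volume := by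
  have h1 : E.indicator (fun x => u (x + v) - u x)
      =ᵐ[volume] fun x => ∫ s in Icc (0 : ℝ) 1, E.indicator (fun x => cdot (g (x + s • v)) v) x := by
    filter_upwards [ae_sub_eq_integral_segment hΩ hu hgm hg hw v] with x hx
    by_cases hxE : x ∈ E
    · simp [hxE, hx (hEv hxE)]
    · simp [hxE]
  rw [eLpNorm_congr_ae h1]
  refine eLpNorm_two_integral_le ?_ fun s hs => ?_
  · have hm : StronglyMeasurable fun p : Rn N × ℝ => cdot (g (p.1 + p.2 • v)) v :=
      (continuous_cdot.comp (Continuous.prodMk_left v)).comp_stronglyMeasurable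
        (hgm.comp_measurable (by fun_prop))
    have := hm.indicator (s := Prod.fst ⁻¹' E) (measurable_fst hE)
    exact this.aestronglyMeasurable
  · calc eLpNorm (E.indicator fun x => cdot (g (x + s • v)) v) 2 volume
        ≤ ENNReal.ofReal ‖v‖ * eLpNorm (fun x => F.indicator g (x + s • v)) 2 volume := by
          refine eLpNorm_le_mul_eLpNorm_of_ae_le_mul (.of_forall fun x => ?_) 2
          by_cases hxE : x ∈ E
          · rw [indicator_of_mem hxE, indicator_of_mem (hEF hxE s hs), mul_comm]
            exact norm_cdot_le _ _
          · rw [indicator_of_notMem hxE, norm_zero]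
            positivity
      _ ≤ ENNReal.ofReal ‖v‖ * eLpNorm (F.indicator g) 2 volume := by
          exact (congrArg _ (eLpNorm_comp_measurePreserving
            (hgm.indicator hF).aestronglyMeasurable
            (measurePreserving_add_right volume (s • v)))).le

/-! ### Boundary strips and the geometry of Lipschitz domains -/

theorem segDomain_mono {N : ℕ} {S Ω : Set (Rn N)} (h : S ⊆ Ω) (v : Rn N) :
    segDomain S v ⊆ segDomain Ω v := fun _ hx s hs => h (hx s hs)

/-- The points of `Ω` at distance less than `t` from the complement of `Ω`. -/
def strip {N : ℕ} (Ω : Set (Rn N)) (t : ℝ) : Set (Rn N) := Ω ∩ Metric.thickening t Ωᶜ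

theorem isOpen_strip {N : ℕ} {Ω : Set (Rn N)} (hΩ : IsOpen Ω) (t : ℝ) : IsOpen (strip Ω t) :=
  hΩ.inter Metric.isOpen_thickening

theorem strip_subset {N : ℕ} (Ω : Set (Rn N)) (t : ℝ) : strip Ω t ⊆ Ω := inter_subset_left

theorem mem_strip {N : ℕ} {Ω : Set (Rn N)} {t : ℝ} {x y : Rn N} (hx : x ∈ Ω) (hy : y ∉ Ω)
    (hxy : dist x y < t) : x ∈ strip Ω t :=
  ⟨hx, Metric.mem_thickening_iff.2 ⟨y, hy, hxy⟩⟩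

/-- The `L²` norm over a boundary strip vanishes with the width of the strip. -/
theorem tendsto_eLpNorm_strip {N : ℕ} {Ω : Set (Rn N)} (hΩ : IsOpen Ω) {F : Type*}
    [NormedAddCommGroup F] {f : Rn N → F} (hf : MemLp f 2 volume) :
    Tendsto (fun t : ℝ => eLpNorm ((strip Ω t).indicator f) 2 volume) (𝓝 0) (𝓝 0) := by
  have sq : ∀ f : Rn N → F, eLpNorm f 2 volume = (∫⁻ x, ‖f x‖ₑ ^ (2 : ℝ)) ^ (1 / 2 : ℝ) := by
    intro f
    rw [eLpNorm_eq_lintegral_rpow_enorm_toReal (by simp) (by simp)]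
    simp
  simp only [sq]
  have h0 : Tendsto (fun t : ℝ => ∫⁻ x, ‖(strip Ω t).indicator f x‖ₑ ^ (2 : ℝ)) (𝓝 0)
      (𝓝 (∫⁻ _ : Rn N, 0)) := by
    refine tendsto_lintegral_filter_of_dominated_convergence' (fun x => ‖f x‖ₑ ^ (2 : ℝ)) ?_ ?_
      ?_ ?_
    · exact .of_forall fun t => ((hf.1.indicator (isOpen_strip hΩ t).measurableSet).enorm).pow_const _
    · refine .of_forall fun t => .of_forall fun x => ?_
      gcongr
      exact enorm_indicator_le_enorm_self _ _
    · have := hf.2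
      rw [sq, ENNReal.rpow_lt_top_iff_of_pos (by norm_num)] at this
      exact this.ne
    · refine .of_forall fun x => ?_
      refine tendsto_const_nhds.congr' ?_
      -- A point of the open set `Ω` has a positive distance `ε` to the complement and leaves the
      -- strip once `t < ε`; dominated convergence does the rest.
      by_cases hx : x ∈ Ω
      · obtain ⟨ε, hε, hb⟩ := Metric.isOpen_iff.1 hΩ x hx
        filter_upwards [Iio_mem_nhds hε] with t ht
        have : x ∉ strip Ω t := by
          rintro ⟨-, h2⟩
          obtain ⟨y, hy, hxy⟩ := Metric.mem_thickening_iff.1 h2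
          exact hy (hb (by rw [Metric.mem_ball, dist_comm]; exact hxy.trans ht))
        simp [this]
      · refine .of_forall fun t => ?_
        have : x ∉ strip Ω t := fun h => hx h.1
        simp [this]
  rw [lintegral_zero] at h0
  have h1 := h0.ennrpow_const (1 / 2 : ℝ)
  simpa using h1

theorem norm_sub_inner_smul_le {N : ℕ} {e : Rn N} (he : ‖e‖ = 1) (h : Rn N) :
    ‖h - inner ℝ e h • e‖ ≤ ‖h‖ := by
  have h1 : ‖h - inner ℝ e h • e‖ ^ 2 = ‖h‖ ^ 2 - (inner ℝ e h) ^ 2 := by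
    rw [norm_sub_sq_real, inner_smul_right, real_inner_comm, norm_smul, he, Real.norm_eq_abs,
      mul_one, sq_abs]
    ring
  refine le_of_sq_le_sq ?_ (norm_nonneg _)
  nlinarith [sq_nonneg (inner ℝ e h)]

theorem inner_add_smul_self {N : ℕ} {e : Rn N} (he : ‖e‖ = 1) (x : Rn N) (c : ℝ) :
    inner ℝ e (x + c • e) = inner ℝ e x + c := by
  rw [inner_add_right, inner_smul_right, real_inner_self_eq_norm_sq, he]
  ring

/-- Otherwise the interior of `Ω` and the complement of its closure would separate `S`. -/
theorem inter_frontier_nonempty_of_isPreconnected {X : Type*} [TopologicalSpace X] {S Ω : Set X}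
    (hS : IsPreconnected S) (h1 : (S ∩ Ω).Nonempty) (h2 : (S ∩ Ωᶜ).Nonempty) :
    (S ∩ frontier Ω).Nonempty := by
  by_contra hcon
  have hno : ∀ y ∈ S, y ∉ frontier Ω := fun y hy hy' => hcon ⟨y, hy, hy'⟩
  obtain ⟨a, haS, ha⟩ := h1
  obtain ⟨b, hbS, hb⟩ := h2
  have hcase : ∀ y ∈ S, y ∈ closure Ω → y ∈ interior Ω := fun y hy hc => by
    by_contra hi
    exact hno y hy ⟨hc, hi⟩
  obtain ⟨y, -, hy1, hy2⟩ := hS (interior Ω) (closure Ω)ᶜ isOpen_interior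
    isClosed_closure.isOpen_compl
    (fun y hy => (em (y ∈ closure Ω)).imp (hcase y hy) id)
    ⟨a, haS, hcase a haS (subset_closure ha)⟩
    ⟨b, hbS, fun hc => hb (interior_subset (hcase b hbS hc))⟩
  exact hy2 (subset_closure (interior_subset hy1))

/-- Pairs of close points of a bounded Lipschitz domain whose segment leaves the domain can be
joined by a three-step path in the domain that moves in one of finitely many directions. -/
theorem exists_finite_directions {N : ℕ} {Ω : Set (Rn N)}
    (hΩb : Bornology.IsBounded Ω) (hΩL : HasLipschitzBoundary Ω) :
    ∃ δ > 0, ∃ T : ℝ, 0 ≤ T ∧ ∃ D : Finset (Rn N), (∀ e ∈ D, ‖e‖ = 1) ∧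
      ∀ x h : Rn N, ‖h‖ < δ → x ∈ Ω → x + h ∈ Ω → x ∉ segDomain Ω h → ∃ e ∈ D,
        x ∈ segDomain (strip Ω ((T + 3) * ‖h‖)) ((T * ‖h‖) • e) ∧
        x + h ∈ segDomain (strip Ω ((T + 3) * ‖h‖)) ((T * ‖h‖) • e) ∧
        x + (T * ‖h‖) • e ∈ segDomain (strip Ω ((T + 3) * ‖h‖)) h := by
  classical
  have hcomp : IsCompact (frontier Ω) :=
    Metric.isCompact_of_isClosed_isBounded isClosed_frontier
      (hΩb.closure.subset frontier_subset_closure)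
  choose! e r K γ he hr hγ hiff using hΩL
  obtain ⟨I, hIsub, hI⟩ := hcomp.elim_nhds_subcover (fun x => Metric.ball x (r x))
    fun x hx => Metric.ball_mem_nhds x (hr x hx)
  -- The Lebesgue number makes the whole path lie in one graph chart, whichever boundary point the
  -- segment meets.
  obtain ⟨δ₀, hδ₀, hleb⟩ := lebesgue_number_lemma_of_metric (ι := I)
    (c := fun i => Metric.ball (i : Rn N) (r i)) hcomp (fun i => Metric.isOpen_ball) (by
      intro x hx
      obtain ⟨i, hi, hxi⟩ := mem_iUnion₂.1 (hI hx)
      exact mem_iUnion.2 ⟨⟨i, hi⟩, hxi⟩)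
  -- A displacement by `s • h` raises the graph by at most `K i * ‖h‖` and lowers the height by at
  -- most `‖h‖`. Lifting by `T * ‖h‖` with `T ≥ K i + 1` compensates for both in every chart.
  set T : ℝ := 1 + ∑ i ∈ I, (K i : ℝ) with hT
  have hT0 : 0 ≤ T := by positivity
  have hTK : ∀ i ∈ I, (K i : ℝ) + 1 ≤ T := by
    intro i hi
    have := Finset.single_le_sum (f := fun i => (K i : ℝ)) (fun j _ => NNReal.coe_nonneg _) hi
    linarith
  clear_value T
  refine ⟨δ₀ / (T + 3), by positivity, T, hT0, I.image e, ?_, ?_⟩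
  · intro v hv
    obtain ⟨i, hi, rfl⟩ := Finset.mem_image.1 hv
    exact he i (hIsub i hi)
  intro x h hhδ hx hxh hbad
  rw [lt_div_iff₀ (by positivity)] at hhδ
  obtain ⟨s₀, hs₀, hout⟩ : ∃ s ∈ Icc (0 : ℝ) 1, x + s • h ∉ Ω := by
    by_contra hcon
    push Not at hcon
    exact hbad hcon
  have hh0 : 0 < ‖h‖ := by
    rw [norm_pos_iff]
    rintro rfl
    simp [hx] at hout
  obtain ⟨z, hz1, hz2⟩ : ((fun s : ℝ => x + s • h) '' Icc 0 1 ∩ frontier Ω).Nonempty := by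
    refine inter_frontier_nonempty_of_isPreconnected ?_ ⟨x, ⟨0, by simp, by simp⟩, hx⟩
      ⟨x + s₀ • h, ⟨s₀, hs₀, rfl⟩, hout⟩
    exact isPreconnected_Icc.image _ (Continuous.continuousOn (by fun_prop))
  obtain ⟨s₁, hs₁, rfl⟩ := hz1
  obtain ⟨⟨i, hi⟩, hball⟩ := hleb _ hz2
  simp only at hball
  have hei := he i (hIsub i hi)
  -- Path points are within `(T + 1) * ‖h‖` of `x` and segment points within `‖h‖`. Their distance
  -- is thus below `(T + 3) * ‖h‖ < δ₀`, which gives both membership in the chart and, using the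
  -- exit point `x + s₀ • h`, in the strip.
  have hnear : ∀ a : Rn N, ‖a‖ ≤ (T + 1) * ‖h‖ →
      (γ i (x + a - inner ℝ (e i) (x + a) • e i) < inner ℝ (e i) (x + a)) →
      x + a ∈ strip Ω ((T + 3) * ‖h‖) := by
    intro a ha hlt
    have hsm : ∀ s ∈ Icc (0 : ℝ) 1, ‖s • h‖ ≤ ‖h‖ := by
      intro s hs
      rw [norm_smul, Real.norm_eq_abs, abs_of_nonneg hs.1]
      exact mul_le_of_le_one_left (norm_nonneg _) hs.2
    have hd : ∀ s ∈ Icc (0 : ℝ) 1, dist (x + a) (x + s • h) < (T + 3) * ‖h‖ := by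
      intro s hs
      rw [dist_add_left, dist_eq_norm]
      have := norm_sub_le a (s • h)
      nlinarith [hsm s hs]
    refine mem_strip ((hiff i (hIsub i hi) _ (hball ?_)).2 hlt) hout (hd s₀ hs₀)
    rw [Metric.mem_ball]
    exact (hd s₁ hs₁).trans (by linarith)
  have hbelow : ∀ a : Rn N, ‖a‖ ≤ ‖h‖ → x + a ∈ Ω →
      γ i (x + a - inner ℝ (e i) (x + a) • e i) < inner ℝ (e i) (x + a) := by
    intro a ha hmem
    refine (hiff i (hIsub i hi) _ (hball ?_)).1 hmem
    rw [Metric.mem_ball, dist_add_left, dist_eq_norm]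
    have h1 := norm_sub_le a (s₁ • h)
    have h2 : ‖s₁ • h‖ ≤ ‖h‖ := by
      rw [norm_smul, Real.norm_eq_abs, abs_of_nonneg hs₁.1]
      exact mul_le_of_le_one_left (norm_nonneg _) hs₁.2
    nlinarith
  have hup : ∀ a : Rn N, ‖a‖ ≤ ‖h‖ → x + a ∈ Ω →
      x + a ∈ segDomain (strip Ω ((T + 3) * ‖h‖)) ((T * ‖h‖) • e i) := by
    intro a ha hmem s hs
    have hc : 0 ≤ s * (T * ‖h‖) := mul_nonneg hs.1 (by positivity)
    have hc' : s * (T * ‖h‖) ≤ T * ‖h‖ := mul_le_of_le_one_left (by positivity) hs.2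
    rw [add_assoc x, smul_smul]
    refine hnear _ ?_ ?_
    · refine (norm_add_le _ _).trans ?_
      rw [norm_smul, hei, Real.norm_eq_abs, abs_of_nonneg hc]
      linarith
    · rw [← add_assoc, inner_add_smul_self hei]
      have := hbelow a ha hmem
      rw [show x + a + (s * (T * ‖h‖)) • e i
        - (inner ℝ (e i) (x + a) + s * (T * ‖h‖)) • e i = x + a - inner ℝ (e i) (x + a) • e i by
          module]
      linarith
  refine ⟨e i, Finset.mem_image_of_mem _ hi, by simpa using hup 0 (by simp) (by simpa using hx),
    hup h le_rfl hxh, ?_⟩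
  intro s hs
  have hsh : ‖s • h‖ ≤ ‖h‖ := by
    rw [norm_smul, Real.norm_eq_abs, abs_of_nonneg hs.1]
    exact mul_le_of_le_one_left (norm_nonneg _) hs.2
  rw [add_assoc x]
  refine hnear _ ?_ ?_
  · refine (norm_add_le _ _).trans ?_
    rw [norm_smul, hei, Real.norm_eq_abs, abs_of_nonneg (by positivity)]
    linarith
  · have h0 : γ i (x - inner ℝ (e i) x • e i) < inner ℝ (e i) x := by
      simpa using hbelow 0 (by simp) (by simpa using hx)
    have e1 : inner ℝ (e i) (x + ((T * ‖h‖) • e i + s • h))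
        = inner ℝ (e i) x + T * ‖h‖ + inner ℝ (e i) (s • h) := by
      rw [← add_assoc, inner_add_right, inner_add_smul_self hei]
    have e2 : x + ((T * ‖h‖) • e i + s • h) -
        inner ℝ (e i) (x + ((T * ‖h‖) • e i + s • h)) • e i
        = (x - inner ℝ (e i) x • e i) + (s • h - inner ℝ (e i) (s • h) • e i) := by
      rw [e1]
      module
    have h1 := (hγ i (hIsub i hi)).dist_le_mul
      ((x - inner ℝ (e i) x • e i) + (s • h - inner ℝ (e i) (s • h) • e i))
      (x - inner ℝ (e i) x • e i)
    rw [dist_self_add_left, Real.dist_eq] at h1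
    have h2 := (norm_sub_inner_smul_le hei (s • h)).trans hsh
    have h3 := abs_real_inner_le_norm (e i) (s • h)
    rw [hei, one_mul] at h3
    rw [e2, e1]
    have h4 := le_abs_self (γ i ((x - inner ℝ (e i) x • e i) +
      (s • h - inner ℝ (e i) (s • h) • e i)) - γ i (x - inner ℝ (e i) x • e i))
    have h5 := neg_abs_le (inner ℝ (e i) (s • h))
    have h6 : (K i : ℝ) * ‖s • h - inner ℝ (e i) (s • h) • e i‖ ≤ K i * ‖h‖ := by gcongr
    have h7 : ((K i : ℝ) + 1) * ‖h‖ ≤ T * ‖h‖ := by gcongr; exact hTK i hi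
    linarith

/-! ### Convergence of the magnetic difference quotients -/

theorem eLpNorm_const_mul_norm {X F : Type*} [MeasurableSpace X] {μ : Measure X}
    [NormedAddCommGroup F] (f : X → F) {c : ℝ} (hc : 0 ≤ c) :
    eLpNorm (fun x => c * ‖f x‖) 2 μ = ENNReal.ofReal c * eLpNorm f 2 μ := by
  have := eLpNorm_const_smul c (fun x => ‖f x‖) 2 μ
  rw [eLpNorm_norm, Real.enorm_of_nonneg hc] at this
  exact this

theorem eLpNorm_two_le_of_norm_le {X F F₁ F₂ F₃ : Type*} [MeasurableSpace X] {μ : Measure X}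
    [NormedAddCommGroup F] [NormedAddCommGroup F₁] [NormedAddCommGroup F₂] [NormedAddCommGroup F₃]
    {f : X → F} {f₁ : X → F₁} {f₂ : X → F₂} {f₃ : X → F₃} {c₂ c₃ : ℝ}
    (h₁ : AEStronglyMeasurable f₁ μ) (h₂ : AEStronglyMeasurable f₂ μ)
    (h₃ : AEStronglyMeasurable f₃ μ) (hc₂ : 0 ≤ c₂) (hc₃ : 0 ≤ c₃)
    (h : ∀ᵐ x ∂μ, ‖f x‖ ≤ ‖f₁ x‖ + c₂ * ‖f₂ x‖ + c₃ * ‖f₃ x‖) :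
    eLpNorm f 2 μ ≤ eLpNorm f₁ 2 μ + ENNReal.ofReal c₂ * eLpNorm f₂ 2 μ
      + ENNReal.ofReal c₃ * eLpNorm f₃ 2 μ := by
  calc eLpNorm f 2 μ
      ≤ eLpNorm ((fun x => ‖f₁ x‖) + (fun x => c₂ * ‖f₂ x‖) + fun x => c₃ * ‖f₃ x‖) 2 μ :=
        eLpNorm_mono_ae_real h
    _ ≤ eLpNorm (fun x => ‖f₁ x‖) 2 μ + eLpNorm (fun x => c₂ * ‖f₂ x‖) 2 μ
        + eLpNorm (fun x => c₃ * ‖f₃ x‖) 2 μ := by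
        refine (eLpNorm_add_le (h₁.norm.add (h₂.norm.const_mul _)) (h₃.norm.const_mul _)
          (by norm_num)).trans ?_
        gcongr
        exact eLpNorm_add_le h₁.norm (h₂.norm.const_mul _) (by norm_num)
    _ = _ := by rw [eLpNorm_norm, eLpNorm_const_mul_norm _ hc₂, eLpNorm_const_mul_norm _ hc₃]

/-- A magnetic potential on a bounded Lipschitz domain, together with a function and its weak
gradient that are square integrable and extended by zero. -/
structure IsExtendedPair {N : ℕ} (Ω : Set (Rn N)) (A : Rn N → Rn N) (u : Rn N → ℂ)
    (g : Rn N → EuclideanSpace ℂ (Fin N)) (C : ℝ) : Prop where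
  isOpen : IsOpen Ω
  isBounded : Bornology.IsBounded Ω
  lipschitz : HasLipschitzBoundary Ω
  u_stronglyMeasurable : StronglyMeasurable u
  u_memLp : MemLp u 2 volume
  u_eq_zero : ∀ x, x ∉ Ω → u x = 0
  g_stronglyMeasurable : StronglyMeasurable g
  g_memLp : MemLp g 2 volume
  g_eq_zero : ∀ x, x ∉ Ω → g x = 0
  weak : IsExtendedWeakGradient Ω u g
  A_aestronglyMeasurable : AEStronglyMeasurable A volume
  A_bound : ∀ x h : Rn N, x ∈ Ω → x + h ∈ Ω → ‖A (x + (1 / 2 : ℝ) • h)‖ ≤ C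
  A_uniformContinuousOn : UniformContinuousOn A Ω

/-- The magnetic phase factor of the pair `(x, x + h)`. -/
noncomputable def phase {N : ℕ} (A : Rn N → Rn N) (x h : Rn N) : ℂ :=
  Complex.exp (Complex.I * (inner ℝ (-h) (A (x + (1 / 2 : ℝ) • h)) : ℝ))

open Classical in
/-- The magnetic difference quotient of the pair `(x, x + h)`. -/
noncomputable def diffQuot {N : ℕ} (Ω : Set (Rn N)) (A : Rn N → Rn N) (u : Rn N → ℂ)
    (h x : Rn N) : ℂ :=
  if x ∈ Ω ∧ x + h ∈ Ω then ((‖h‖⁻¹ : ℝ) : ℂ) * (u x - phase A x h * u (x + h)) else 0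

namespace IsExtendedPair

variable {N : ℕ} {Ω : Set (Rn N)} {A : Rn N → Rn N} {u : Rn N → ℂ}
  {g : Rn N → EuclideanSpace ℂ (Fin N)} {C : ℝ}

/-! ### Bounds and measurability for a pair extended by zero -/

theorem integrable_of_eq_zero {F : Type*} [NormedAddCommGroup F] {f : Rn N → F}
    (hΩ : Bornology.IsBounded Ω) (hf : MemLp f 2 volume) (h0 : ∀ x, x ∉ Ω → f x = 0) :
    Integrable f volume := by
  obtain ⟨r, hr⟩ := hΩ.subset_closedBall 0
  have : IsFiniteMeasure (volume.restrict (Metric.closedBall (0 : Rn N) r)) :=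
    ⟨by simpa using measure_closedBall_lt_top⟩
  have h1 : IntegrableOn f (Metric.closedBall 0 r) volume :=
    (hf.restrict _).integrable (by norm_num)
  refine (integrableOn_iff_integrable_of_support_subset ?_).1 h1
  intro x hx
  by_contra hx'
  exact hx (h0 x fun hxΩ => hx' (hr hxΩ))

theorem u_integrable (H : IsExtendedPair Ω A u g C) : Integrable u volume :=
  integrable_of_eq_zero H.isBounded H.u_memLp H.u_eq_zero

theorem g_integrable (H : IsExtendedPair Ω A u g C) : Integrable g volume :=
  integrable_of_eq_zero H.isBounded H.g_memLp H.g_eq_zero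

theorem norm_A_le (H : IsExtendedPair Ω A u g C) {x : Rn N} (hx : x ∈ Ω) : ‖A x‖ ≤ C := by
  simpa using H.A_bound x 0 hx (by simpa using hx)

theorem magneticGradient_eq_zero (H : IsExtendedPair Ω A u g C) {x : Rn N} (hx : x ∉ Ω) :
    magneticGradient A u g x = 0 := by
  ext i
  simp [magneticGradient, H.u_eq_zero x hx, H.g_eq_zero x hx]

theorem aestronglyMeasurable_magneticGradient (H : IsExtendedPair Ω A u g C) :
    AEStronglyMeasurable (magneticGradient A u g) volume := by
  have h1 : Continuous fun p : Rn N × ℂ × EuclideanSpace ℂ (Fin N) =>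
      (WithLp.toLp 2 fun j => p.2.2 j - Complex.I * (p.1 j : ℂ) * p.2.1 :
        EuclideanSpace ℂ (Fin N)) := by fun_prop
  exact h1.comp_aestronglyMeasurable (H.A_aestronglyMeasurable.prodMk
    (H.u_memLp.1.prodMk H.g_memLp.1))

theorem norm_magneticGradient_le (A : Rn N → Rn N) (u : Rn N → ℂ)
    (g : Rn N → EuclideanSpace ℂ (Fin N)) (x : Rn N) :
    ‖magneticGradient A u g x‖ ≤ ‖g x‖ + ‖A x‖ * ‖u x‖ := by
  have h1 : magneticGradient A u g x
      = g x - (Complex.I * u x) • (WithLp.toLp 2 fun i => (A x i : ℂ)) := by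
    ext i
    simp [magneticGradient]
    ring
  have h2 : ‖(WithLp.toLp 2 (fun i => (A x i : ℂ)) : EuclideanSpace ℂ (Fin N))‖ = ‖A x‖ := by
    simp [EuclideanSpace.norm_eq]
  rw [h1]
  refine (norm_sub_le _ _).trans ?_
  rw [norm_smul, h2]
  simp [mul_comm]

theorem memLp_magneticGradient (H : IsExtendedPair Ω A u g C) :
    MemLp (magneticGradient A u g) 2 volume := by
  refine (H.g_memLp.norm.add (H.u_memLp.norm.const_mul |C|)).mono'
    H.aestronglyMeasurable_magneticGradient (.of_forall fun x => ?_)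
  by_cases hx : x ∈ Ω
  · refine (norm_magneticGradient_le A u g x).trans ?_
    simp only [Pi.add_apply]
    gcongr
    exact (H.norm_A_le hx).trans (le_abs_self C)
  · rw [H.magneticGradient_eq_zero hx, norm_zero]
    simp only [Pi.add_apply]
    positivity

theorem norm_phase (A : Rn N → Rn N) (x h : Rn N) : ‖phase A x h‖ = 1 := by
  rw [phase, mul_comm]
  exact Complex.norm_exp_ofReal_mul_I _

theorem abs_inner_A_le (H : IsExtendedPair Ω A u g C) {x h : Rn N} (hx : x ∈ Ω) (hxh : x + h ∈ Ω) :
    |inner ℝ (-h) (A (x + (1 / 2 : ℝ) • h))| ≤ C * ‖h‖ := by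
  refine (abs_real_inner_le_norm _ _).trans ?_
  rw [norm_neg, mul_comm]
  gcongr
  exact H.A_bound x h hx hxh

theorem norm_one_sub_phase_le (H : IsExtendedPair Ω A u g C) {x h : Rn N} (hx : x ∈ Ω)
    (hxh : x + h ∈ Ω) : ‖1 - phase A x h‖ ≤ C * ‖h‖ := by
  rw [norm_sub_rev, phase]
  exact Real.norm_exp_I_mul_ofReal_sub_one_le.trans (H.abs_inner_A_le hx hxh)

theorem aestronglyMeasurable_phase (H : IsExtendedPair Ω A u g C) (h : Rn N) :
    AEStronglyMeasurable (fun x => phase A x h) volume := by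
  have h1 := H.A_aestronglyMeasurable.comp_measurePreserving
    (measurePreserving_add_right volume ((1 / 2 : ℝ) • h))
  have h2 : Continuous fun a : Rn N => Complex.exp (Complex.I * (inner ℝ (-h) a : ℝ)) := by
    fun_prop
  exact h2.comp_aestronglyMeasurable h1

theorem aestronglyMeasurable_u_translate (H : IsExtendedPair Ω A u g C) (h : Rn N) :
    AEStronglyMeasurable (fun x => u (x + h)) volume :=
  H.u_memLp.1.comp_measurePreserving (measurePreserving_add_right volume h)

theorem diffQuot_eq_indicator (h : Rn N) : diffQuot Ω A u h
    = (Ω ∩ (fun x => x + h) ⁻¹' Ω).indicator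
      fun x => ((‖h‖⁻¹ : ℝ) : ℂ) * (u x - phase A x h * u (x + h)) := by
  classical
  ext x
  simp only [diffQuot, indicator_apply, mem_inter_iff, mem_preimage]

theorem aestronglyMeasurable_diffQuot (H : IsExtendedPair Ω A u g C) (h : Rn N) :
    AEStronglyMeasurable (diffQuot Ω A u h) volume := by
  rw [diffQuot_eq_indicator]
  refine AEStronglyMeasurable.indicator ?_ ?_
  · exact (H.u_memLp.1.sub ((H.aestronglyMeasurable_phase h).mul
      (H.aestronglyMeasurable_u_translate h))).const_mul _
  · exact H.isOpen.measurableSet.inter (measurable_id.add_const h H.isOpen.measurableSet)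

theorem eLpNorm_u_translate (H : IsExtendedPair Ω A u g C) (h : Rn N) :
    eLpNorm (fun x => u (x + h)) 2 volume = eLpNorm u 2 volume :=
  eLpNorm_comp_measurePreserving H.u_memLp.1 (measurePreserving_add_right volume h)

/-- This crude bound degenerates as `h → 0`; it serves for square integrability at fixed `h` and for
boundedness of the energy away from the origin. -/
theorem eLpNorm_diffQuot_le (H : IsExtendedPair Ω A u g C) (h : Rn N) :
    eLpNorm (diffQuot Ω A u h) 2 volume
      ≤ ENNReal.ofReal ‖h‖⁻¹ * eLpNorm u 2 volume + ENNReal.ofReal ‖h‖⁻¹ * eLpNorm u 2 volume := by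
  have := eLpNorm_two_le_of_norm_le (f := diffQuot Ω A u h) (f₁ := fun _ => (0 : ℂ)) (f₂ := u)
    (f₃ := fun x => u (x + h)) aestronglyMeasurable_const H.u_memLp.1
    (H.aestronglyMeasurable_u_translate h) (c₂ := ‖h‖⁻¹) (c₃ := ‖h‖⁻¹) (by positivity)
    (by positivity) (.of_forall fun x => ?_)
  · rw [H.eLpNorm_u_translate] at this
    simpa using this
  · rw [norm_zero, zero_add, ← mul_add, diffQuot]
    split_ifs with hx
    · rw [norm_mul, Complex.norm_real, norm_inv, norm_norm]
      gcongr
      refine (norm_sub_le _ _).trans ?_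
      rw [norm_mul, norm_phase, one_mul]
    · rw [norm_zero]
      positivity

theorem memLp_diffQuot (H : IsExtendedPair Ω A u g C) (h : Rn N) :
    MemLp (diffQuot Ω A u h) 2 volume :=
  ⟨H.aestronglyMeasurable_diffQuot h, (H.eLpNorm_diffQuot_le h).trans_lt (by
    have := H.u_memLp.2
    exact ENNReal.add_lt_top.2 ⟨ENNReal.mul_lt_top ENNReal.ofReal_lt_top this,
      ENNReal.mul_lt_top ENNReal.ofReal_lt_top this⟩)⟩

/-- The plus sign on the left arises because `u x - u (x + h)` approximates `-∇u · h`. On the right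
stand the three errors: oscillation of the gradient along the segment, the first-order remainder of
the phase, and the replacement of `u x` by `u (x + h)` in the term with `A`. -/
theorem ae_diffQuot_add_eq (H : IsExtendedPair Ω A u g C) (h : Rn N) :
    ∀ᵐ x, x ∈ segDomain Ω h →
      diffQuot Ω A u h x + cdot (magneticGradient A u g x) (‖h‖⁻¹ • h)
        = -(∫ s in Icc (0 : ℝ) 1, cdot (g (x + s • h) - g x) (‖h‖⁻¹ • h))
          + (((‖h‖⁻¹ : ℝ) : ℂ) * (1 - phase A x h)
              - Complex.I * (inner ℝ (‖h‖⁻¹ • h) (A x) : ℝ)) * u (x + h)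
          + Complex.I * (inner ℝ (‖h‖⁻¹ • h) (A x) : ℝ) * (u (x + h) - u x) := by
  filter_upwards [ae_sub_eq_integral_segment H.isOpen H.u_integrable H.g_stronglyMeasurable
    H.g_integrable H.weak h,
    (integrable_cdot_segment H.g_stronglyMeasurable H.g_integrable h).prod_right_ae] with x hx hint hxs
  have hftc := hx hxs
  have h1 : ∫ s in Icc (0 : ℝ) 1, cdot (g (x + s • h) - g x) (‖h‖⁻¹ • h)
      = ((‖h‖⁻¹ : ℝ) : ℂ) * (u (x + h) - u x) - cdot (g x) (‖h‖⁻¹ • h) := by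
    have e1 : ∀ s : ℝ, cdot (g (x + s • h) - g x) (‖h‖⁻¹ • h)
        = ((‖h‖⁻¹ : ℝ) : ℂ) * cdot (g (x + s • h)) h - cdot (g x) (‖h‖⁻¹ • h) := by
      intro s
      rw [cdot_sub, cdot_smul (g (x + s • h))]
    simp only [e1]
    rw [integral_sub (hint.const_mul _) (integrable_const _), integral_const_mul, ← hftc]
    simp
  rw [h1, diffQuot, if_pos ⟨segDomain_subset Ω h hxs, add_mem_of_mem_segDomain hxs⟩,
    cdot_magneticGradient]
  ring

/-- By Minkowski it suffices to bound each `s`; since `‖s • h‖ ≤ ‖h‖`, continuity of translations is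
uniform in `s`. -/
theorem eLpNorm_integral_cdot_sub_le (H : IsExtendedPair Ω A u g C) {ε : ENNReal} (hε : 0 < ε) :
    ∀ᶠ h in 𝓝[≠] (0 : Rn N), eLpNorm (fun x => ∫ s in Icc (0 : ℝ) 1,
      cdot (g (x + s • h) - g x) (‖h‖⁻¹ • h)) 2 volume ≤ ε := by
  have h1 := (ENNReal.tendsto_nhds_zero.1 (tendsto_eLpNorm_translate_sub H.g_memLp)) ε hε
  obtain ⟨δ, hδ, hball⟩ := Metric.eventually_nhds_iff.1 h1
  have h2 : ∀ᶠ h in 𝓝[≠] (0 : Rn N), dist h 0 < δ :=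
    eventually_nhdsWithin_of_eventually_nhds (Metric.ball_mem_nhds 0 hδ)
  filter_upwards [h2, self_mem_nhdsWithin] with h hh hh0
  have hh0' : ‖h‖ ≠ 0 := norm_ne_zero_iff.2 hh0
  refine eLpNorm_two_integral_le (k := fun x s => cdot (g (x + s • h) - g x) (‖h‖⁻¹ • h)) ?_ ?_
  · have hgm := H.g_stronglyMeasurable
    have hm : StronglyMeasurable fun p : Rn N × ℝ => g (p.1 + p.2 • h) - g p.1 :=
      (hgm.comp_measurable (by fun_prop)).sub (hgm.comp_measurable measurable_fst)
    exact ((continuous_cdot.comp (Continuous.prodMk_left (‖h‖⁻¹ • h))).comp_stronglyMeasurable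
      hm).aestronglyMeasurable
  · intro s hs
    refine (eLpNorm_mono (g := fun x => g (x + s • h) - g x) fun x => ?_).trans
      (hball (y := s • h) ?_)
    · refine (norm_cdot_le _ _).trans ?_
      rw [norm_smul, norm_inv, norm_norm, inv_mul_cancel₀ hh0', mul_one]
    · rw [dist_zero_right] at hh ⊢
      refine lt_of_le_of_lt ?_ hh
      rw [norm_smul, Real.norm_eq_abs, abs_of_nonneg hs.1]
      exact mul_le_of_le_one_left (norm_nonneg _) hs.2

theorem norm_phase_remainder_le (H : IsExtendedPair Ω A u g C) {η : ℝ} (hη : 0 < η) :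
    ∀ᶠ h in 𝓝[≠] (0 : Rn N), ∀ x ∈ segDomain Ω h,
      ‖((‖h‖⁻¹ : ℝ) : ℂ) * (1 - phase A x h)
        - Complex.I * (inner ℝ (‖h‖⁻¹ • h) (A x) : ℝ)‖ ≤ η := by
  obtain ⟨δ, hδ, huc⟩ := Metric.uniformContinuousOn_iff.1 H.A_uniformContinuousOn (η / 2)
    (by positivity)
  have hlim : ∀ {c : ℝ}, 0 < c → ∀ k : ℝ, ∀ᶠ h in 𝓝[≠] (0 : Rn N), k * ‖h‖ < c := by
    intro c hc k
    have : Tendsto (fun h : Rn N => k * ‖h‖) (𝓝 0) (𝓝 0) := by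
      have : Continuous fun h : Rn N => k * ‖h‖ := by fun_prop
      simpa using this.tendsto 0
    exact eventually_nhdsWithin_of_eventually_nhds (this.eventually (gt_mem_nhds hc))
  -- The three smallness conditions serve uniform continuity of `A` between `x` and the midpoint,
  -- the bound `|θ| ≤ 1` needed for the Taylor estimate of `exp`, and the quadratic remainder `C ^ 2
  -- * ‖h‖ ^ 2` after division by `‖h‖`.
  filter_upwards [hlim hδ 1, hlim one_pos C, hlim (half_pos hη) (C ^ 2), self_mem_nhdsWithin]
    with h h1 h2 h3 hh0 x hx
  have hpos : 0 < ‖h‖ := norm_pos_iff.2 hh0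
  have hxΩ := segDomain_subset Ω h hx
  have hxh := add_mem_of_mem_segDomain hx
  have hm : x + (1 / 2 : ℝ) • h ∈ Ω := hx (1 / 2) (by norm_num)
  have hA : ‖A (x + (1 / 2 : ℝ) • h) - A x‖ ≤ η / 2 := by
    rw [← dist_eq_norm]
    refine (huc _ hm _ hxΩ ?_).le
    rw [dist_self_add_left, norm_smul]
    norm_num
    linarith
  set θ : ℝ := inner ℝ (-h) (A (x + (1 / 2 : ℝ) • h)) with hθ
  have hθle : |θ| ≤ C * ‖h‖ := H.abs_inner_A_le hxΩ hxh
  have hnθ : ‖Complex.I * (θ : ℂ)‖ = |θ| := by simp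
  have hrem := Complex.norm_exp_sub_one_sub_id_le (x := Complex.I * θ)
    (by rw [hnθ]; linarith)
  rw [hnθ] at hrem
  have hθ' : θ = -(‖h‖ * inner ℝ (‖h‖⁻¹ • h) (A (x + (1 / 2 : ℝ) • h))) := by
    rw [hθ, inner_neg_left, real_inner_smul_left, mul_inv_cancel_left₀ hpos.ne']
  have hinn : (inner ℝ (‖h‖⁻¹ • h) (A x) : ℝ)
      = -(‖h‖⁻¹ * θ) - inner ℝ (‖h‖⁻¹ • h) (A (x + (1 / 2 : ℝ) • h) - A x) := by
    rw [hθ', inner_sub_right]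
    field_simp
    ring
  have hsplit : ((‖h‖⁻¹ : ℝ) : ℂ) * (1 - phase A x h)
        - Complex.I * (inner ℝ (‖h‖⁻¹ • h) (A x) : ℝ)
      = -((‖h‖⁻¹ : ℝ) : ℂ) * (Complex.exp (Complex.I * θ) - 1 - Complex.I * θ)
        + Complex.I * (inner ℝ (‖h‖⁻¹ • h) (A (x + (1 / 2 : ℝ) • h) - A x) : ℝ) := by
    rw [hinn, phase, ← hθ]
    push_cast
    ring
  rw [hsplit]
  refine (norm_add_le _ _).trans ?_
  rw [norm_mul, norm_mul, norm_neg, Complex.norm_I, one_mul, Complex.norm_real, Complex.norm_real,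
    norm_inv, norm_norm]
  have hb1 : ‖h‖⁻¹ * ‖Complex.exp (Complex.I * θ) - 1 - Complex.I * θ‖ ≤ η / 2 := by
    have : |θ| ^ 2 ≤ (C * ‖h‖) ^ 2 := by gcongr
    rw [inv_mul_le_iff₀ hpos]
    nlinarith
  have hb2 : ‖(inner ℝ (‖h‖⁻¹ • h) (A (x + (1 / 2 : ℝ) • h) - A x) : ℝ)‖ ≤ η / 2 := by
    refine (norm_inner_le_norm _ _).trans ?_
    rw [norm_smul, norm_inv, norm_norm, inv_mul_cancel₀ hpos.ne', one_mul]
    exact hA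
  linarith

theorem exists_ofReal_mul_le {ε c : ENNReal} (hε : 0 < ε) (hc : c ≠ ⊤) :
    ∃ η : ℝ, 0 < η ∧ ENNReal.ofReal η * c ≤ ε := by
  have h1 : Tendsto (fun η : ℝ => ENNReal.ofReal η * c) (𝓝[>] 0) (𝓝 0) := by
    have h2 : Tendsto (fun η : ℝ => ENNReal.ofReal η) (𝓝[>] 0) (𝓝 0) := by
      have := (ENNReal.continuous_ofReal.tendsto 0).mono_left
        (nhdsWithin_le_nhds (s := Ioi (0 : ℝ)))
      simpa using this
    have := ENNReal.Tendsto.mul_const h2 (b := c) (Or.inr hc)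
    simpa using this
  obtain ⟨η, h2, h3⟩ := ((ENNReal.tendsto_nhds_zero.1 h1 ε hε).and self_mem_nhdsWithin).exists
  exact ⟨η, h3, h2⟩

theorem tendsto_of_forall_eventually_le_add {X : Type*} {l : Filter X} {f : X → ENNReal}
    (h : ∀ ε : ENNReal, 0 < ε → ∀ᶠ x in l, f x ≤ ε + ε + ε) : Tendsto f l (𝓝 0) := by
  rw [ENNReal.tendsto_nhds_zero]
  intro ε hε
  filter_upwards [h (ε / 3) (ENNReal.div_pos hε.ne' (by simp))] with x hx
  exact hx.trans_eq (ENNReal.add_thirds ε)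

theorem tendsto_eLpNorm_good (H : IsExtendedPair Ω A u g C) :
    Tendsto (fun h => eLpNorm ((segDomain Ω h).indicator fun x =>
      diffQuot Ω A u h x + cdot (magneticGradient A u g x) (‖h‖⁻¹ • h)) 2 volume)
      (𝓝[≠] 0) (𝓝 0) := by
  refine tendsto_of_forall_eventually_le_add fun ε hε => ?_
  obtain ⟨η, hη, hηε⟩ := exists_ofReal_mul_le hε H.u_memLp.2.ne
  have h3 : ∀ᶠ h in 𝓝[≠] (0 : Rn N),
      ENNReal.ofReal |C| * eLpNorm (fun x => u (x + h) - u x) 2 volume ≤ ε := by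
    have := ENNReal.Tendsto.const_mul (tendsto_eLpNorm_translate_sub H.u_memLp)
      (a := ENNReal.ofReal |C|) (Or.inr ENNReal.ofReal_ne_top)
    rw [mul_zero] at this
    exact eventually_nhdsWithin_of_eventually_nhds (ENNReal.tendsto_nhds_zero.1 this ε hε)
  filter_upwards [H.eLpNorm_integral_cdot_sub_le hε, H.norm_phase_remainder_le hη, h3,
    self_mem_nhdsWithin] with h h1 h2 h3 hh0
  have hpos : 0 < ‖h‖ := norm_pos_iff.2 hh0
  have hm1 : AEStronglyMeasurable (fun x => ∫ s in Icc (0 : ℝ) 1,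
      cdot (g (x + s • h) - g x) (‖h‖⁻¹ • h)) volume := by
    have hgm := H.g_stronglyMeasurable
    have hm : StronglyMeasurable fun p : Rn N × ℝ => g (p.1 + p.2 • h) - g p.1 :=
      (hgm.comp_measurable (by fun_prop)).sub (hgm.comp_measurable measurable_fst)
    exact (((continuous_cdot.comp (Continuous.prodMk_left (‖h‖⁻¹ • h))).comp_stronglyMeasurable
      hm).integral_prod_right' (ν := volume.restrict (Icc (0 : ℝ) 1))).aestronglyMeasurable
  refine (eLpNorm_two_le_of_norm_le hm1 (H.aestronglyMeasurable_u_translate h)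
    ((H.aestronglyMeasurable_u_translate h).sub H.u_memLp.1) hη.le (abs_nonneg C) ?_).trans
    (add_le_add (add_le_add h1 ?_) h3)
  · filter_upwards [H.ae_diffQuot_add_eq h] with x hx
    by_cases hxs : x ∈ segDomain Ω h
    · rw [indicator_of_mem hxs, hx hxs]
      refine (norm_add₃_le).trans ?_
      rw [norm_neg, norm_mul, norm_mul]
      gcongr
      · exact h2 x hxs
      · rw [norm_mul, Complex.norm_I, one_mul, Complex.norm_real]
        refine (norm_inner_le_norm _ _).trans ?_
        rw [norm_smul, norm_inv, norm_norm, inv_mul_cancel₀ hpos.ne', one_mul]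
        exact (H.norm_A_le (segDomain_subset Ω h hxs)).trans (le_abs_self C)
      · rfl
    · rw [indicator_of_notMem hxs, norm_zero]
      positivity
  · rw [H.eLpNorm_u_translate]
    exact hηε

/-! ### Contributions near the boundary -/

/-- The contribution of the magnetic gradient near the boundary. -/
theorem tendsto_eLpNorm_cdot_compl (H : IsExtendedPair Ω A u g C) :
    Tendsto (fun h => eLpNorm ((segDomain Ω h)ᶜ.indicator fun x =>
      cdot (magneticGradient A u g x) (‖h‖⁻¹ • h)) 2 volume) (𝓝[≠] 0) (𝓝 0) := by
  have h1 : Tendsto (fun h : Rn N => eLpNorm ((strip Ω (2 * ‖h‖)).indicator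
      (magneticGradient A u g)) 2 volume) (𝓝[≠] 0) (𝓝 0) := by
    refine (tendsto_eLpNorm_strip H.isOpen H.memLp_magneticGradient).comp ?_
    have : Continuous fun h : Rn N => 2 * ‖h‖ := by fun_prop
    simpa using (this.tendsto 0).mono_left nhdsWithin_le_nhds
  refine tendsto_of_tendsto_of_tendsto_of_le_of_le' tendsto_const_nhds h1
    (.of_forall fun _ => zero_le) ?_
  filter_upwards [self_mem_nhdsWithin] with h hh0
  have hpos : 0 < ‖h‖ := norm_pos_iff.2 hh0
  refine eLpNorm_mono fun x => ?_
  by_cases hx : x ∈ segDomain Ω h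
  · rw [indicator_of_notMem (by simpa using hx), norm_zero]
    positivity
  rw [indicator_of_mem (by simpa using hx)]
  by_cases hxΩ : x ∈ Ω
  -- The segment leaves `Ω` within distance `‖h‖`; the factor `2` provides the strict inequality in
  -- the definition of the strip.
  · have hxs : x ∈ strip Ω (2 * ‖h‖) := by
      simp only [segDomain, mem_ofPred_eq, not_forall] at hx
      obtain ⟨s, hs, hs'⟩ := hx
      refine mem_strip hxΩ hs' ?_
      rw [dist_self_add_right, norm_smul, Real.norm_eq_abs, abs_of_nonneg hs.1]
      nlinarith [hs.2]
    rw [indicator_of_mem hxs]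
    refine (norm_cdot_le _ _).trans ?_
    rw [norm_smul, norm_inv, norm_norm, inv_mul_cancel₀ hpos.ne', mul_one]
  · rw [H.magneticGradient_eq_zero hxΩ, cdot_zero_left, norm_zero]
    positivity

/-- A translate compared along a three-step path inside an open set `S ⊆ Ω`. -/
theorem eLpNorm_indicator_three_step_le (H : IsExtendedPair Ω A u g C) {S E : Set (Rn N)}
    (hS : IsOpen S) (hSΩ : S ⊆ Ω) {h v : Rn N} (hE : MeasurableSet E)
    (h1 : ∀ x ∈ E, x ∈ segDomain S v) (h2 : ∀ x ∈ E, x + h ∈ segDomain S v)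
    (h3 : ∀ x ∈ E, x + v ∈ segDomain S h) :
    eLpNorm (E.indicator fun x => u (x + h) - u x) 2 volume
      ≤ ENNReal.ofReal (2 * ‖v‖ + ‖h‖) * eLpNorm (S.indicator g) 2 volume := by
  set M := eLpNorm (S.indicator g) 2 volume
  have hmeas : ∀ a : Rn N, MeasurableSet ((fun x => x - a) ⁻¹' E) := fun a =>
    (measurable_id.sub_const a) hE
  have hbound : ∀ a w : Rn N, (∀ x ∈ E, x + a ∈ segDomain S w) →
      eLpNorm (E.indicator fun x => u (x + a + w) - u (x + a)) 2 volume
        ≤ ENNReal.ofReal ‖w‖ * M := by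
    intro a w ha
    have hsub : (fun x => x - a) ⁻¹' E ⊆ segDomain S w := fun y hy => by
      simpa using ha _ hy
    have hb := eLpNorm_indicator_translate_sub_le H.isOpen H.u_integrable H.g_stronglyMeasurable
      H.g_integrable H.weak w (hmeas a) hS.measurableSet (hsub.trans (segDomain_mono hSΩ w)) hsub
    have hm : AEStronglyMeasurable (((fun x => x - a) ⁻¹' E).indicator
        fun x => u (x + w) - u x) volume :=
      ((H.aestronglyMeasurable_u_translate w).sub H.u_memLp.1).indicator (hmeas a)
    rw [← eLpNorm_comp_measurePreserving hm (measurePreserving_add_right volume a)] at hb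
    refine le_of_eq_of_le (congrArg (fun f => eLpNorm f 2 volume) ?_) hb
    ext x
    by_cases hx : x ∈ E <;> simp [indicator, hx]
  have hm : ∀ a w : Rn N, AEStronglyMeasurable
      (E.indicator fun x => u (x + a + w) - u (x + a)) volume := by
    intro a w
    simp only [add_assoc]
    exact ((H.aestronglyMeasurable_u_translate (a + w)).sub
      (H.aestronglyMeasurable_u_translate a)).indicator hE
  -- The path is `x → x + v → x + v + h → x + h`, with the last leg traversed backwards; hence the
  -- length `2 * ‖v‖ + ‖h‖`.
  have key := eLpNorm_two_le_of_norm_le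
    (f := E.indicator fun x => u (x + h) - u x) (hm 0 v) (hm v h) (hm h v)
    zero_le_one zero_le_one (.of_forall fun x => ?_)
  · refine (key.trans (add_le_add (add_le_add (hbound 0 v (by simpa using h1))
      (mul_le_mul_right (hbound v h h3) _)) (mul_le_mul_right (hbound h v h2) _))).trans_eq ?_
    rw [ENNReal.ofReal_one, one_mul, one_mul, ← add_mul, ← add_mul,
      ← ENNReal.ofReal_add (by positivity) (by positivity),
      ← ENNReal.ofReal_add (by positivity) (by positivity)]
    congr 2
    ring
  · by_cases hx : x ∈ E
    · simp only [indicator_of_mem hx, add_zero, one_mul]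
      have : u (x + h) - u x = (u (x + v) - u x) + (u (x + v + h) - u (x + v))
          + -(u (x + h + v) - u (x + h)) := by
        rw [add_right_comm x v h]
        ring
      rw [this]
      refine norm_add₃_le.trans ?_
      rw [norm_neg]
    · simp [hx]

/-- The pairs `(x, x + h)` in `Ω` whose segment leaves `Ω`, as a set of points `x`. -/
def leaving (Ω : Set (Rn N)) (h : Rn N) : Set (Rn N) :=
  (Ω ∩ (fun x => x + h) ⁻¹' Ω) \ segDomain Ω h

theorem measurableSet_leaving (hΩ : IsOpen Ω) (h : Rn N) : MeasurableSet (leaving Ω h) :=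
  (hΩ.measurableSet.inter (measurable_id.add_const h hΩ.measurableSet)).diff
    (isOpen_segDomain hΩ h).measurableSet

theorem tendsto_strip_norm (hΩ : IsOpen Ω) {F : Type*} [NormedAddCommGroup F] {f : Rn N → F}
    (hf : MemLp f 2 volume) (c : ℝ) :
    Tendsto (fun h : Rn N => eLpNorm ((strip Ω (c * ‖h‖)).indicator f) 2 volume)
      (𝓝[≠] 0) (𝓝 0) := by
  refine (tendsto_eLpNorm_strip hΩ hf).comp ?_
  have : Continuous fun h : Rn N => c * ‖h‖ := by fun_prop
  simpa using (this.tendsto 0).mono_left nhdsWithin_le_nhds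

/-- The admissible direction varies with `x`, but only finitely many occur. The sets `E e` cover
`leaving Ω h`, and summing the three-step bound over `D` costs only the factor `D.card`. -/
theorem exists_eLpNorm_leaving_le (H : IsExtendedPair Ω A u g C) :
    ∃ c a : ℝ, 0 ≤ a ∧ ∀ᶠ h in 𝓝[≠] (0 : Rn N),
      eLpNorm ((leaving Ω h).indicator fun x => u (x + h) - u x) 2 volume
        ≤ ENNReal.ofReal (a * ‖h‖) * eLpNorm ((strip Ω (c * ‖h‖)).indicator g) 2 volume := by
  obtain ⟨δ, hδ, T, hT, D, hD, hpath⟩ := exists_finite_directions H.isBounded H.lipschitz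
  refine ⟨T + 3, D.card * (2 * T + 1), by positivity, ?_⟩
  have h0 : ∀ᶠ h in 𝓝[≠] (0 : Rn N), dist h 0 < δ :=
    eventually_nhdsWithin_of_eventually_nhds (Metric.ball_mem_nhds 0 hδ)
  filter_upwards [h0] with h hh
  rw [dist_zero_right] at hh
  set S := strip Ω ((T + 3) * ‖h‖)
  have hS : IsOpen S := isOpen_strip H.isOpen _
  let E : Rn N → Set (Rn N) := fun e =>
    segDomain S ((T * ‖h‖) • e) ∩ (fun x => x + h) ⁻¹' segDomain S ((T * ‖h‖) • e)
      ∩ (fun x => x + (T * ‖h‖) • e) ⁻¹' segDomain S h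
  have hEm : ∀ e, MeasurableSet (E e) := fun e =>
    (((isOpen_segDomain hS _).inter ((isOpen_segDomain hS _).preimage (by fun_prop))).inter
      ((isOpen_segDomain hS _).preimage (by fun_prop))).measurableSet
  have hm : ∀ e, AEStronglyMeasurable ((E e).indicator fun x => u (x + h) - u x) volume :=
    fun e => ((H.aestronglyMeasurable_u_translate h).sub H.u_memLp.1).indicator (hEm e)
  calc eLpNorm ((leaving Ω h).indicator fun x => u (x + h) - u x) 2 volume
      ≤ eLpNorm (∑ e ∈ D, fun x => ‖(E e).indicator (fun x => u (x + h) - u x) x‖) 2 volume := by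
        refine eLpNorm_mono_real fun x => ?_
        rw [Finset.sum_apply]
        by_cases hx : x ∈ leaving Ω h
        · obtain ⟨e, he, p1, p2, p3⟩ := hpath x h hh hx.1.1 hx.1.2 hx.2
          have hxE : x ∈ E e := ⟨⟨p1, p2⟩, p3⟩
          rw [indicator_of_mem hx]
          refine le_trans ?_ (Finset.single_le_sum
            (f := fun e => ‖(E e).indicator (fun x => u (x + h) - u x) x‖)
            (fun _ _ => norm_nonneg _) he)
          rw [indicator_of_mem hxE]
        · rw [indicator_of_notMem hx, norm_zero]
          exact Finset.sum_nonneg fun _ _ => norm_nonneg _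
    _ ≤ ∑ e ∈ D, eLpNorm (fun x => ‖(E e).indicator (fun x => u (x + h) - u x) x‖) 2 volume :=
        eLpNorm_sum_le (fun e _ => (hm e).norm) (by norm_num)
    _ ≤ ∑ e ∈ D, ENNReal.ofReal ((2 * T + 1) * ‖h‖) * eLpNorm (S.indicator g) 2 volume := by
        refine Finset.sum_le_sum fun e he => ?_
        rw [eLpNorm_norm]
        refine (H.eLpNorm_indicator_three_step_le hS (strip_subset _ _) (hEm e)
          (fun x hx => hx.1.1) (fun x hx => hx.1.2) fun x hx => hx.2).trans_eq ?_
        rw [norm_smul, hD e he, Real.norm_eq_abs, abs_of_nonneg (by positivity)]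
        congr 2
        ring
    _ = _ := by
        rw [Finset.sum_const, nsmul_eq_mul, ← mul_assoc, ← ENNReal.ofReal_natCast,
          ← ENNReal.ofReal_mul (by positivity), mul_assoc]

theorem leaving_subset_preimage_strip {h x : Rn N} (hh : 0 < ‖h‖) (hx : x ∈ leaving Ω h) :
    x + h ∈ strip Ω (2 * ‖h‖) := by
  have hx2 := hx.2
  simp only [segDomain, mem_ofPred_eq, not_forall] at hx2
  obtain ⟨s, hs, hs'⟩ := hx2
  refine mem_strip hx.1.2 hs' ?_
  rw [dist_add_left, dist_eq_norm, show h - s • h = (1 - s) • h by module, norm_smul,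
    Real.norm_eq_abs, abs_of_nonneg (by linarith [hs.2])]
  nlinarith [hs.1]

/-- The contribution of the pairs whose segment leaves the domain. -/
theorem tendsto_eLpNorm_diffQuot_leaving (H : IsExtendedPair Ω A u g C) :
    Tendsto (fun h => eLpNorm ((leaving Ω h).indicator (diffQuot Ω A u h)) 2 volume)
      (𝓝[≠] 0) (𝓝 0) := by
  obtain ⟨c, a, ha, hca⟩ := H.exists_eLpNorm_leaving_le
  have hlim : Tendsto (fun h : Rn N =>
      ENNReal.ofReal a * eLpNorm ((strip Ω (c * ‖h‖)).indicator g) 2 volume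
        + ENNReal.ofReal |C| * eLpNorm ((strip Ω (2 * ‖h‖)).indicator u) 2 volume)
      (𝓝[≠] 0) (𝓝 0) := by
    have t1 := ENNReal.Tendsto.const_mul (tendsto_strip_norm H.isOpen H.g_memLp c)
      (a := ENNReal.ofReal a) (Or.inr ENNReal.ofReal_ne_top)
    have t2 := ENNReal.Tendsto.const_mul (tendsto_strip_norm H.isOpen H.u_memLp 2)
      (a := ENNReal.ofReal |C|) (Or.inr ENNReal.ofReal_ne_top)
    simpa using t1.add t2
  refine tendsto_of_tendsto_of_tendsto_of_le_of_le' tendsto_const_nhds hlim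
    (.of_forall fun _ => zero_le) ?_
  filter_upwards [hca, self_mem_nhdsWithin] with h hh hh0
  have hpos : 0 < ‖h‖ := norm_pos_iff.2 hh0
  have hSm := (isOpen_strip H.isOpen (2 * ‖h‖)).measurableSet
  have hm1 : AEStronglyMeasurable ((strip Ω (2 * ‖h‖)).indicator u) volume :=
    H.u_memLp.1.indicator hSm
  have hmp := measurePreserving_add_right (volume : Measure (Rn N)) h
  have key := eLpNorm_two_le_of_norm_le (μ := volume)
    (f := (leaving Ω h).indicator (diffQuot Ω A u h)) (f₁ := fun _ => (0 : ℂ))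
    (f₂ := (leaving Ω h).indicator fun x => u (x + h) - u x)
    (f₃ := fun x => (strip Ω (2 * ‖h‖)).indicator u (x + h)) (c₂ := ‖h‖⁻¹) (c₃ := |C|)
    aestronglyMeasurable_const
    (((H.aestronglyMeasurable_u_translate h).sub H.u_memLp.1).indicator
      (measurableSet_leaving H.isOpen h))
    (hm1.comp_measurePreserving hmp) (by positivity) (abs_nonneg C) (.of_forall fun x => ?_)
  · refine key.trans (add_le_add ?_ ?_)
    · rw [eLpNorm_zero', zero_add]
      refine (mul_le_mul_right hh _).trans_eq ?_
      rw [← mul_assoc, ← ENNReal.ofReal_mul (by positivity)]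
      congr 2
      field_simp
    · exact (congrArg _ (eLpNorm_comp_measurePreserving hm1 hmp)).le
  · by_cases hx : x ∈ leaving Ω h
    · rw [indicator_of_mem hx, indicator_of_mem hx,
        indicator_of_mem (leaving_subset_preimage_strip hpos hx), diffQuot,
        if_pos (show x ∈ Ω ∧ x + h ∈ Ω from hx.1),
        norm_zero, zero_add, norm_mul, Complex.norm_real, norm_inv, norm_norm]
      -- The first part has the size of the translate already estimated; the second is at most `|C|
      -- * ‖h‖ * ‖u (x + h)‖`, and `x + h` lies in the strip.
      have e1 : u x - phase A x h * u (x + h)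
          = -(u (x + h) - u x) + (1 - phase A x h) * u (x + h) := by ring
      have hC := (H.norm_one_sub_phase_le hx.1.1 hx.1.2).trans
        (mul_le_mul_of_nonneg_right (le_abs_self C) hpos.le)
      rw [e1, inv_mul_le_iff₀ hpos, mul_add, mul_inv_cancel_left₀ hpos.ne']
      refine (norm_add_le _ _).trans ?_
      rw [norm_neg, norm_mul, ← mul_assoc, mul_comm ‖h‖]
      gcongr
    · rw [indicator_of_notMem hx, norm_zero]
      positivity

/-- The magnetic difference quotients converge in `L²` to the directional derivatives. -/
theorem tendsto_eLpNorm_diffQuot_add (H : IsExtendedPair Ω A u g C) :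
    Tendsto (fun h => eLpNorm (fun x =>
      diffQuot Ω A u h x + cdot (magneticGradient A u g x) (‖h‖⁻¹ • h)) 2 volume)
      (𝓝[≠] 0) (𝓝 0) := by
  have hlim := (H.tendsto_eLpNorm_good.add H.tendsto_eLpNorm_cdot_compl).add
    H.tendsto_eLpNorm_diffQuot_leaving
  simp only [add_zero] at hlim
  refine tendsto_of_tendsto_of_tendsto_of_le_of_le' tendsto_const_nhds hlim
    (.of_forall fun _ => zero_le) (.of_forall fun h => ?_)
  have hms := (isOpen_segDomain H.isOpen h).measurableSet
  have hmc : AEStronglyMeasurable (fun x => cdot (magneticGradient A u g x) (‖h‖⁻¹ • h)) volume :=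
    (continuous_cdot.comp (Continuous.prodMk_left _)).comp_aestronglyMeasurable
      H.aestronglyMeasurable_magneticGradient
  have hmd := H.aestronglyMeasurable_diffQuot h
  have key := eLpNorm_two_le_of_norm_le (c₂ := 1) (c₃ := 1)
    (f := fun x => diffQuot Ω A u h x + cdot (magneticGradient A u g x) (‖h‖⁻¹ • h))
    ((hmd.add hmc).indicator hms) (hmc.indicator hms.compl)
    (hmd.indicator (measurableSet_leaving H.isOpen h)) zero_le_one zero_le_one
    (.of_forall fun x => ?_)
  · rw [ENNReal.ofReal_one, one_mul, one_mul] at key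
    exact key
  · rw [one_mul, one_mul]
    by_cases hx : x ∈ segDomain Ω h
    · rw [indicator_of_mem hx]
      simp only [Pi.add_apply]
      linarith [norm_nonneg ((segDomain Ω h)ᶜ.indicator
        (fun x => cdot (magneticGradient A u g x) (‖h‖⁻¹ • h)) x),
        norm_nonneg ((leaving Ω h).indicator (diffQuot Ω A u h) x)]
    · rw [indicator_of_notMem hx, indicator_of_mem (by simpa using hx), norm_zero, zero_add,
        add_comm]
      refine (norm_add_le _ _).trans ?_
      gcongr
      by_cases hx' : x ∈ leaving Ω h
      · rw [indicator_of_mem hx']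
      -- Outside both `segDomain Ω h` and `leaving Ω h` an endpoint lies outside `Ω`, so the
      -- difference quotient is zero.
      · have : ¬(x ∈ Ω ∧ x + h ∈ Ω) := fun hc => hx' ⟨hc, hx⟩
        rw [diffQuot, if_neg this, norm_zero]
        positivity

end IsExtendedPair

/-! ### Radial approximate identities -/

theorem integral_norm_eq {N : ℕ} (hN : 1 ≤ N) (φ : ℝ → ℝ) :
    ∫ x : Rn N, φ ‖x‖ = (∫ r in Ioi (0 : ℝ), φ r * r ^ (N - 1)) *
      (volume : Measure (Rn N)).toSphere.real univ := by
  have := integral_norm_mul_direction hN φ fun _ => 1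
  simpa using this

/-- Radial approximate identities annihilate bounded functions vanishing at the origin. -/
theorem tendsto_integral_radial_mul {N : ℕ} (hN : 1 ≤ N)
    {ρ : ℕ → ℝ → ℝ} (hρ0 : ∀ n r, 0 ≤ r → 0 ≤ ρ n r)
    (hρ1 : ∀ n, Integrable (fun x : Rn N => ρ n ‖x‖) volume)
    (hρlim : Tendsto (fun n => ∫ r in Ioi (0 : ℝ), ρ n r * r ^ (N - 1)) atTop (𝓝 1))
    (hρtail : ∀ δ : ℝ, 0 < δ →
      Tendsto (fun n => ∫ r in Ioi δ, ρ n r * r ^ (N - 1)) atTop (𝓝 0))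
    {k : Rn N → ℝ} {B : ℝ} (hB : ∀ h, |k h| ≤ B) (hk : Tendsto k (𝓝 0) (𝓝 0)) :
    Tendsto (fun n => ∫ h, ρ n ‖h‖ * k h) atTop (𝓝 0) := by
  set m := (volume : Measure (Rn N)).toSphere.real univ with hm
  have hB0 : 0 ≤ B := (abs_nonneg _).trans (hB 0)
  have hm0 : 0 ≤ m := measureReal_nonneg
  rw [Metric.tendsto_nhds]
  intro ε hε
  set ε' := ε / (2 * (m + 1)) with hε'
  have hε'0 : 0 < ε' := by positivity
  obtain ⟨δ, hδ, hball⟩ := Metric.eventually_nhds_iff.1 (Metric.tendsto_nhds.1 hk ε' hε'0)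
  -- The integrand is at most `ε' * ρ` on `‖h‖ ≤ δ / 2` and `B * ρ` beyond it. The choice of `ε'`
  -- makes the limit of the total bound smaller than `ε`.
  have hlim : Tendsto (fun n => ε' * ((∫ r in Ioi (0 : ℝ), ρ n r * r ^ (N - 1)) * m)
      + B * ((∫ r in Ioi (δ / 2), ρ n r * r ^ (N - 1)) * m)) atTop
      (𝓝 (ε' * (1 * m) + B * (0 * m))) :=
    ((hρlim.mul_const m).const_mul ε').add (((hρtail _ (half_pos hδ)).mul_const m).const_mul B)
  have hlt : ε' * (1 * m) + B * (0 * m) < ε := by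
    have : ε' * (2 * (m + 1)) = ε := by rw [hε']; field_simp
    nlinarith
  filter_upwards [hlim.eventually (gt_mem_nhds hlt)] with n hn
  refine lt_of_le_of_lt ?_ hn
  have htail : ∫ h : Rn N, (Ioi (δ / 2)).indicator (ρ n) ‖h‖
      = (∫ r in Ioi (δ / 2), ρ n r * r ^ (N - 1)) * m := by
    rw [integral_norm_eq hN]
    congr 1
    have : ∀ r : ℝ, (Ioi (δ / 2)).indicator (ρ n) r * r ^ (N - 1)
        = (Ioi (δ / 2)).indicator (fun r => ρ n r * r ^ (N - 1)) r := by
      intro r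
      by_cases hr : r ∈ Ioi (δ / 2) <;> simp [hr]
    simp_rw [this]
    rw [setIntegral_indicator measurableSet_Ioi]
    congr 2
    exact inter_eq_right.2 (Ioi_subset_Ioi (by positivity))
  have htaili : Integrable (fun h : Rn N => (Ioi (δ / 2)).indicator (ρ n) ‖h‖) volume := by
    have : (fun h : Rn N => (Ioi (δ / 2)).indicator (ρ n) ‖h‖)
        = (norm ⁻¹' Ioi (δ / 2)).indicator fun h : Rn N => ρ n ‖h‖ := by
      ext h
      by_cases hh : δ / 2 < ‖h‖ <;> simp [indicator, hh]
    rw [this]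
    exact (hρ1 n).indicator (measurable_norm measurableSet_Ioi)
  rw [← htail, ← integral_norm_eq hN, dist_zero_right, ← integral_const_mul, ← integral_const_mul,
    ← integral_add ((hρ1 n).const_mul _) (htaili.const_mul _)]
  refine norm_integral_le_of_norm_le (((hρ1 n).const_mul _).add (htaili.const_mul _))
    (.of_forall fun h => ?_)
  have hρh := hρ0 n ‖h‖ (norm_nonneg _)
  rw [norm_mul, Real.norm_eq_abs, Real.norm_eq_abs, abs_of_nonneg hρh]
  by_cases hh : ‖h‖ ∈ Ioi (δ / 2)
  · rw [indicator_of_mem hh]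
    nlinarith [mul_le_mul_of_nonneg_left (hB h) hρh, mul_nonneg hε'0.le hρh]
  · rw [indicator_of_notMem hh, mul_zero, add_zero, mul_comm]
    refine mul_le_mul_of_nonneg_right ?_ hρh
    have hh' : ‖h‖ ≤ δ / 2 := not_lt.1 hh
    have := hball (y := h) (by rw [dist_zero_right]; linarith)
    rw [dist_zero_right] at this
    exact this.le

theorem aestronglyMeasurable_cdot {X : Type*} [MeasurableSpace X] {N : ℕ}
    {f : X → EuclideanSpace ℂ (Fin N)} {k : X → Rn N} {μ : Measure X}
    (hf : AEStronglyMeasurable f μ) (hk : AEStronglyMeasurable k μ) :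
    AEStronglyMeasurable (fun p => cdot (f p) (k p)) μ := by
  have h := continuous_cdot.comp_aestronglyMeasurable (hf.prodMk hk)
  exact h

/-! ### Convergence of energies and passage to the limit -/

namespace IsExtendedPair

variable {N : ℕ} {Ω : Set (Rn N)} {A : Rn N → Rn N} {u : Rn N → ℂ}
  {g : Rn N → EuclideanSpace ℂ (Fin N)} {C : ℝ}

/-- The strongly measurable representative of `u` can be composed freely, while `A` is only almost
everywhere measurable and needs the midpoint map to be quasi-measure-preserving. -/
theorem aestronglyMeasurable_diffQuot_prod (H : IsExtendedPair Ω A u g C) :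
    AEStronglyMeasurable (fun p : Rn N × Rn N => diffQuot Ω A u p.1 p.2)
      (volume.prod volume) := by
  classical
  have hS : MeasurableSet {p : Rn N × Rn N | p.2 ∈ Ω ∧ p.2 + p.1 ∈ Ω} :=
    (measurable_snd H.isOpen.measurableSet).inter
      ((measurable_snd.add measurable_fst) H.isOpen.measurableSet)
  have hq : Measure.QuasiMeasurePreserving (fun p : Rn N × Rn N => p.2 + (1 / 2 : ℝ) • p.1)
      (volume.prod volume) volume :=
    QuasiMeasurePreserving.prod_of_right (by fun_prop) (.of_forall fun h =>
      (measurePreserving_add_right volume ((1 / 2 : ℝ) • h)).quasiMeasurePreserving)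
  have hA : AEStronglyMeasurable (fun p : Rn N × Rn N => A (p.2 + (1 / 2 : ℝ) • p.1))
      (volume.prod volume) := H.A_aestronglyMeasurable.comp_quasiMeasurePreserving hq
  have hphase : AEStronglyMeasurable (fun p : Rn N × Rn N => phase A p.2 p.1)
      (volume.prod volume) := by
    have hc : Continuous fun q : Rn N × Rn N =>
        Complex.exp (Complex.I * (inner ℝ (-q.1) q.2 : ℝ)) := by fun_prop
    have h0 : AEStronglyMeasurable (fun p : Rn N × Rn N => p.1) (volume.prod volume) :=
      measurable_fst.aestronglyMeasurable
    have h1 := hc.comp_aestronglyMeasurable (h0.prodMk hA)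
    exact h1
  have hum := H.u_stronglyMeasurable
  have h1 : AEStronglyMeasurable (fun p : Rn N × Rn N => u p.2) (volume.prod volume) :=
    (hum.comp_measurable measurable_snd).aestronglyMeasurable
  have h2 : AEStronglyMeasurable (fun p : Rn N × Rn N => u (p.2 + p.1)) (volume.prod volume) :=
    (hum.comp_measurable (measurable_snd.add measurable_fst)).aestronglyMeasurable
  have h3 : AEStronglyMeasurable (fun p : Rn N × Rn N => ((‖p.1‖⁻¹ : ℝ) : ℂ))
      (volume.prod volume) := by
    have : Measurable fun p : Rn N × Rn N => ((‖p.1‖⁻¹ : ℝ) : ℂ) := by fun_prop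
    exact this.aestronglyMeasurable
  refine ((h3.mul (h1.sub (hphase.mul h2))).indicator hS).congr (.of_forall fun p => ?_)
  simp [diffQuot, indicator_apply]

theorem aestronglyMeasurable_cdot_prod (H : IsExtendedPair Ω A u g C) :
    AEStronglyMeasurable (fun p : Rn N × Rn N =>
      cdot (magneticGradient A u g p.2) (‖p.1‖⁻¹ • p.1)) (volume.prod volume) := by
  have h1 : Measurable fun p : Rn N × Rn N => ‖p.1‖⁻¹ • p.1 := by fun_prop
  have h2 : AEStronglyMeasurable (fun p : Rn N × Rn N => magneticGradient A u g p.2)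
      (volume.prod volume) := H.aestronglyMeasurable_magneticGradient.comp_snd
  exact aestronglyMeasurable_cdot h2 h1.aestronglyMeasurable

theorem memLp_cdot (H : IsExtendedPair Ω A u g C) (v : Rn N) :
    MemLp (fun x => cdot (magneticGradient A u g x) v) 2 volume := by
  refine (H.memLp_magneticGradient.norm.mul_const ‖v‖).mono'
    ((continuous_cdot.comp (Continuous.prodMk_left v)).comp_aestronglyMeasurable
      H.aestronglyMeasurable_magneticGradient) (.of_forall fun x => norm_cdot_le _ _)

theorem norm_inv_smul_le (h : Rn N) : ‖‖h‖⁻¹ • h‖ ≤ 1 := by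
  rw [norm_smul, norm_inv, norm_norm]
  exact inv_mul_le_one

theorem eLpNorm_cdot_le (H : IsExtendedPair Ω A u g C) (h : Rn N) :
    (eLpNorm (fun x => cdot (magneticGradient A u g x) (‖h‖⁻¹ • h)) 2 volume).toReal
      ≤ (eLpNorm (magneticGradient A u g) 2 volume).toReal := by
  refine ENNReal.toReal_mono H.memLp_magneticGradient.2.ne (eLpNorm_mono fun x => ?_)
  refine (norm_cdot_le _ _).trans (mul_le_of_le_one_right (norm_nonneg _) (norm_inv_smul_le h))

/-- The difference of the energies of the difference quotient and of the directional derivative. -/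
theorem tendsto_energy_sub (H : IsExtendedPair Ω A u g C) :
    Tendsto (fun h => (∫ x, ‖diffQuot Ω A u h x‖ ^ 2)
      - ∫ x, ‖cdot (magneticGradient A u g x) (‖h‖⁻¹ • h)‖ ^ 2) (𝓝 0) (𝓝 0) := by
  -- The kernel lemma asks for the full neighbourhood filter. At `h = 0` the convention `0⁻¹ = 0`
  -- makes both energies vanish.
  rw [← nhdsNE_sup_pure, tendsto_sup]
  refine ⟨?_, ?_⟩
  swap
  · have : ((∫ x, ‖diffQuot Ω A u (0 : Rn N) x‖ ^ 2)
      - ∫ x, ‖cdot (magneticGradient A u g x) (‖(0 : Rn N)‖⁻¹ • (0 : Rn N))‖ ^ 2) = 0 := by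
      simp [diffQuot, cdot]
    rw [tendsto_pure_left]
    intro s hs
    simp only [this]
    exact mem_of_mem_nhds hs
  set W := (eLpNorm (magneticGradient A u g) 2 volume).toReal
  set c : Rn N → ℝ := fun h => (eLpNorm (fun x =>
      diffQuot Ω A u h x + cdot (magneticGradient A u g x) (‖h‖⁻¹ • h)) 2 volume).toReal with hc
  have hclim : Tendsto c (𝓝[≠] 0) (𝓝 0) := by
    have := (ENNReal.tendsto_toReal ENNReal.zero_ne_top).comp H.tendsto_eLpNorm_diffQuot_add
    exact this
  have hlim : Tendsto (fun h => c h * (c h + 2 * W)) (𝓝[≠] 0) (𝓝 0) := by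
    have := hclim.mul (hclim.add_const (2 * W))
    simpa using this
  refine squeeze_zero_norm (fun h => ?_) hlim
  have hd := H.memLp_diffQuot h
  have hw := H.memLp_cdot (‖h‖⁻¹ • h)
  have hs : MemLp (fun x =>
      diffQuot Ω A u h x + cdot (magneticGradient A u g x) (‖h‖⁻¹ • h)) 2 volume := hd.add hw
  rw [integral_norm_sq_eq hd, integral_norm_sq_eq hw]
  set a := (eLpNorm (diffQuot Ω A u h) 2 volume).toReal
  set b := (eLpNorm (fun x => cdot (magneticGradient A u g x) (‖h‖⁻¹ • h)) 2 volume).toReal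
  have hb : b ≤ W := H.eLpNorm_cdot_le h
  have ha0 : 0 ≤ a := ENNReal.toReal_nonneg
  have hb0 : 0 ≤ b := ENNReal.toReal_nonneg
  have h1 : a ≤ c h + b := by
    refine le_of_le_of_eq ?_ (ENNReal.toReal_add hs.2.ne hw.2.ne)
    refine ENNReal.toReal_mono (ENNReal.add_ne_top.2 ⟨hs.2.ne, hw.2.ne⟩) ?_
    refine le_trans (le_of_eq (congrArg (fun f => eLpNorm f 2 volume) ?_))
      (eLpNorm_sub_le hs.1 hw.1 (by norm_num))
    ext x
    simp
  have h2 : b ≤ c h + a := by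
    refine le_of_le_of_eq ?_ (ENNReal.toReal_add hs.2.ne hd.2.ne)
    refine ENNReal.toReal_mono (ENNReal.add_ne_top.2 ⟨hs.2.ne, hd.2.ne⟩) ?_
    refine le_trans (le_of_eq (congrArg (fun f => eLpNorm f 2 volume) ?_))
      (eLpNorm_sub_le hs.1 hd.1 (by norm_num))
    ext x
    simp
  -- Then `|a ^ 2 - b ^ 2| = |a - b| * (a + b) ≤ c h * (c h + 2 * W)`, because `b ≤ W`.
  have hab : |a - b| ≤ c h := abs_le.2 ⟨by linarith, by linarith⟩
  rw [Real.norm_eq_abs, sq_sub_sq, abs_mul, abs_of_nonneg (add_nonneg ha0 hb0), mul_comm]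
  exact mul_le_mul hab (by linarith) (by positivity) ((abs_nonneg _).trans hab)

/-- Near the origin the energy is within `1` of a directional energy bounded by `W ^ 2`; for `‖h‖ ≥
δ` the crude bound applies with `‖h‖⁻¹ ≤ δ⁻¹`. -/
theorem exists_energy_bound (H : IsExtendedPair Ω A u g C) :
    ∃ B : ℝ, ∀ h, ∫ x, ‖diffQuot Ω A u h x‖ ^ 2 ≤ B := by
  obtain ⟨δ, hδ, hball⟩ := Metric.eventually_nhds_iff.1
    (Metric.tendsto_nhds.1 H.tendsto_energy_sub 1 one_pos)
  set W := (eLpNorm (magneticGradient A u g) 2 volume).toReal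
  set M := (eLpNorm u 2 volume).toReal
  have hM0 : 0 ≤ M := ENNReal.toReal_nonneg
  refine ⟨max (W ^ 2 + 1) ((δ⁻¹ * M + δ⁻¹ * M) ^ 2), fun h => ?_⟩
  by_cases hh : dist h 0 < δ
  · refine le_max_of_le_left ?_
    have h1 := hball hh
    rw [dist_zero_right, Real.norm_eq_abs] at h1
    have h2 := (abs_lt.1 h1).2
    have h3 : ∫ x, ‖cdot (magneticGradient A u g x) (‖h‖⁻¹ • h)‖ ^ 2 ≤ W ^ 2 := by
      rw [integral_norm_sq_eq (H.memLp_cdot _)]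
      gcongr
      exact H.eLpNorm_cdot_le h
    linarith
  · refine le_max_of_le_right ?_
    rw [dist_zero_right, not_lt] at hh
    rw [integral_norm_sq_eq (H.memLp_diffQuot h)]
    gcongr
    have hle : ENNReal.ofReal ‖h‖⁻¹ * eLpNorm u 2 volume ≠ ⊤ :=
      ENNReal.mul_ne_top ENNReal.ofReal_ne_top H.u_memLp.2.ne
    have h1 := ENNReal.toReal_mono (ENNReal.add_ne_top.2 ⟨hle, hle⟩) (H.eLpNorm_diffQuot_le h)
    rw [ENNReal.toReal_add hle hle, ENNReal.toReal_mul, ENNReal.toReal_ofReal (by positivity)] at h1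
    refine h1.trans ?_
    gcongr

theorem integral_sphere_energy (H : IsExtendedPair Ω A u g C) (hN : 1 ≤ N) {e : Rn N}
    (he : ‖e‖ = 1) :
    ∫ w : Metric.sphere (0 : Rn N) 1,
      (∫ x, ‖cdot (magneticGradient A u g x) (w : Rn N)‖ ^ 2) ∂(volume : Measure (Rn N)).toSphere
      = 2 * bbmConstant e * ∫ x, ‖magneticGradient A u g x‖ ^ 2 := by
  have hW := H.memLp_magneticGradient.integrable_norm_pow (p := 2) (by norm_num)
  have hm : AEStronglyMeasurable (fun p : Metric.sphere (0 : Rn N) 1 × Rn N =>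
      ‖cdot (magneticGradient A u g p.2) (p.1 : Rn N)‖ ^ 2)
      ((volume : Measure (Rn N)).toSphere.prod volume) := by
    have h1 : Measurable fun p : Metric.sphere (0 : Rn N) 1 × Rn N => (p.1 : Rn N) := by fun_prop
    have h2 : AEStronglyMeasurable (fun p : Metric.sphere (0 : Rn N) 1 × Rn N =>
        magneticGradient A u g p.2) ((volume : Measure (Rn N)).toSphere.prod volume) :=
      H.aestronglyMeasurable_magneticGradient.comp_snd
    exact (aestronglyMeasurable_cdot h2 h1.aestronglyMeasurable).norm.pow 2
  have hi : Integrable (fun p : Metric.sphere (0 : Rn N) 1 × Rn N =>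
      ‖cdot (magneticGradient A u g p.2) (p.1 : Rn N)‖ ^ 2)
      ((volume : Measure (Rn N)).toSphere.prod volume) := by
    refine (hW.comp_snd _).mono' hm (.of_forall fun p => ?_)
    rw [Real.norm_eq_abs, abs_of_nonneg (by positivity)]
    have hp : ‖(p.1 : Rn N)‖ = 1 := by simp
    gcongr
    refine (norm_cdot_le _ _).trans ?_
    rw [hp, mul_one]
  rw [integral_integral_swap hi, ← integral_const_mul]
  refine integral_congr_ae (.of_forall fun x => ?_)
  exact integral_sphere_cdot_sq hN he _

/-- The limit formula in the variables `h = y - x` and `x`. -/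
theorem tendsto_integral_diffQuot (H : IsExtendedPair Ω A u g C) (hN : 1 ≤ N)
    {ρ : ℕ → ℝ → ℝ} (hρ0 : ∀ n r, 0 ≤ r → 0 ≤ ρ n r)
    (hρ1 : ∀ n, Integrable (fun x : Rn N => ρ n ‖x‖) volume)
    (hρlim : Tendsto (fun n => ∫ r in Ioi (0 : ℝ), ρ n r * r ^ (N - 1)) atTop (𝓝 1))
    (hρtail : ∀ δ : ℝ, 0 < δ →
      Tendsto (fun n => ∫ r in Ioi δ, ρ n r * r ^ (N - 1)) atTop (𝓝 0))
    {e : Rn N} (he : ‖e‖ = 1) :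
    (∀ n, Integrable (fun p : Rn N × Rn N => ‖diffQuot Ω A u p.1 p.2‖ ^ 2 * ρ n ‖p.1‖)
      (volume.prod volume)) ∧
    Tendsto (fun n => ∫ p : Rn N × Rn N, ‖diffQuot Ω A u p.1 p.2‖ ^ 2 * ρ n ‖p.1‖
      ∂(volume.prod volume)) atTop
      (𝓝 (2 * bbmConstant e * ∫ x, ‖magneticGradient A u g x‖ ^ 2)) := by
  obtain ⟨B, hB⟩ := H.exists_energy_bound
  set W := (eLpNorm (magneticGradient A u g) 2 volume).toReal
  set I : Rn N → ℝ := fun h => ∫ x, ‖diffQuot Ω A u h x‖ ^ 2 with hI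
  set J : Rn N → ℝ := fun h => ∫ x, ‖cdot (magneticGradient A u g x) (‖h‖⁻¹ • h)‖ ^ 2 with hJ
  have hI0 : ∀ h, 0 ≤ I h := fun h => integral_nonneg fun x => by positivity
  have hJ0 : ∀ h, 0 ≤ J h := fun h => integral_nonneg fun x => by positivity
  have hJB : ∀ h, J h ≤ W ^ 2 := fun h => by
    simp only [hJ]
    rw [integral_norm_sq_eq (H.memLp_cdot _)]
    gcongr
    exact H.eLpNorm_cdot_le h
  have hIm : AEStronglyMeasurable I volume :=
    (H.aestronglyMeasurable_diffQuot_prod.norm.pow 2).integral_prod_right'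
  have hJm : AEStronglyMeasurable J volume :=
    (H.aestronglyMeasurable_cdot_prod.norm.pow 2).integral_prod_right'
  have hIi : ∀ n, Integrable (fun h => ρ n ‖h‖ * I h) volume := fun n =>
    (hρ1 n).mul_bdd (c := B) hIm (.of_forall fun h => by
      rw [Real.norm_eq_abs, abs_of_nonneg (hI0 h)]
      exact hB h)
  have hJi : ∀ n, Integrable (fun h => ρ n ‖h‖ * J h) volume := fun n =>
    (hρ1 n).mul_bdd (c := W ^ 2) hJm (.of_forall fun h => by
      rw [Real.norm_eq_abs, abs_of_nonneg (hJ0 h)]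
      exact hJB h)
  have hint : ∀ n, Integrable (fun p : Rn N × Rn N =>
      ‖diffQuot Ω A u p.1 p.2‖ ^ 2 * ρ n ‖p.1‖) (volume.prod volume) := by
    intro n
    have hm : AEStronglyMeasurable (fun p : Rn N × Rn N =>
        ‖diffQuot Ω A u p.1 p.2‖ ^ 2 * ρ n ‖p.1‖) (volume.prod volume) :=
      (H.aestronglyMeasurable_diffQuot_prod.norm.pow 2).mul (hρ1 n).1.comp_fst
    rw [integrable_prod_iff hm]
    refine ⟨.of_forall fun h => ?_, (hIi n).congr (.of_forall fun h => ?_)⟩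
    · exact ((H.memLp_diffQuot h).integrable_norm_pow (p := 2) (by norm_num)).mul_const (ρ n ‖h‖)
    · simp only [hI, norm_mul, norm_pow, norm_norm]
      rw [integral_mul_const, Real.norm_eq_abs, abs_of_nonneg (hρ0 n _ (norm_nonneg _)), mul_comm]
  refine ⟨hint, ?_⟩
  have heq : ∀ n, ∫ p : Rn N × Rn N, ‖diffQuot Ω A u p.1 p.2‖ ^ 2 * ρ n ‖p.1‖
      ∂(volume.prod volume)
      = (∫ h, ρ n ‖h‖ * (I h - J h)) + (∫ r in Ioi (0 : ℝ), ρ n r * r ^ (N - 1)) *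
        (2 * bbmConstant e * ∫ x, ‖magneticGradient A u g x‖ ^ 2) := by
    intro n
    -- Since `J` depends on the direction alone, its contribution is exact for every `n`; only `I -
    -- J` requires a limit.
    have hpolar := integral_norm_mul_direction hN (ρ n)
      fun v => ∫ x, ‖cdot (magneticGradient A u g x) v‖ ^ 2
    rw [H.integral_sphere_energy hN he] at hpolar
    rw [← hpolar, integral_prod _ (hint n)]
    have e1 : ∀ h, ρ n ‖h‖ * (I h - J h) = ρ n ‖h‖ * I h - ρ n ‖h‖ * J h := fun h => by ring
    simp only [e1]
    rw [integral_sub (hIi n) (hJi n), sub_add_cancel]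
    refine integral_congr_ae (.of_forall fun h => ?_)
    simp only [hI]
    rw [integral_mul_const, mul_comm]
  have hlim := (tendsto_integral_radial_mul hN hρ0 hρ1 hρlim hρtail
    (k := fun h => I h - J h) (B := B + W ^ 2) (fun h => abs_le.2
      ⟨by linarith [hI0 h, hJB h, (hI0 h).trans (hB h)],
        by linarith [hJ0 h, hB h, sq_nonneg W]⟩) H.tendsto_energy_sub).add
    (hρlim.mul_const (2 * bbmConstant e * ∫ x, ‖magneticGradient A u g x‖ ^ 2))
  rw [zero_add, one_mul] at hlim
  exact hlim.congr fun n => (heq n).symm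

end IsExtendedPair

/-! ### Reduction to functions extended by zero -/

theorem integrable_mul_testFunction {N : ℕ} {Ω : Set (Rn N)} {f : Rn N → ℂ}
    (hf : LocallyIntegrableOn f Ω volume) {φ : Rn N → ℝ} (hφ : Continuous φ)
    (hφc : HasCompactSupport φ) (hφs : tsupport φ ⊆ Ω) :
    Integrable (fun x => f x * (φ x : ℂ)) volume := by
  obtain ⟨C', hC'⟩ := hφc.exists_bound_of_continuous hφ
  have h1 : IntegrableOn f (tsupport φ) volume := hf.integrableOn_compact_subset hφs hφc
  have h2 : IntegrableOn (fun x => f x * (φ x : ℂ)) (tsupport φ) volume :=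
    Integrable.mul_bdd (c := C') h1 (Continuous.aestronglyMeasurable (by fun_prop))
      (.of_forall fun x => by rw [Complex.norm_real]; exact hC' x)
  refine (integrableOn_iff_integrable_of_support_subset fun x hx => ?_).1 h2
  refine subset_tsupport φ fun h => hx ?_
  simp [h]

theorem locallyIntegrableOn_coord {N : ℕ} {Ω : Set (Rn N)} {G : Rn N → EuclideanSpace ℂ (Fin N)}
    (hG : LocallyIntegrableOn G Ω volume) (i : Fin N) :
    LocallyIntegrableOn (fun x => G x i) Ω volume := by
  intro x hx
  obtain ⟨U, hU, hi⟩ := hG x hx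
  exact ⟨U, hU, (EuclideanSpace.proj (𝕜 := ℂ) i : EuclideanSpace ℂ (Fin N) →L[ℂ] ℂ).integrable_comp
    hi⟩

/-- Weak gradients are unique up to null sets. -/
theorem IsWeakGradient.ae_eq {N : ℕ} {Ω : Set (Rn N)} (hΩ : IsOpen Ω) {u : Rn N → ℂ}
    {G G' : Rn N → EuclideanSpace ℂ (Fin N)} (hG : IsWeakGradient Ω u G)
    (hG' : IsWeakGradient Ω u G') : G =ᵐ[volume.restrict Ω] G' := by
  have hi : ∀ i : Fin N, ∀ᵐ x, x ∈ Ω → G x i - G' x i = 0 := by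
    intro i
    have l1 := locallyIntegrableOn_coord hG.2.1 i
    have l2 := locallyIntegrableOn_coord hG'.2.1 i
    refine hΩ.ae_eq_zero_of_integral_contDiff_smul_eq_zero (l1.sub l2) fun φ hφ hφc hφs => ?_
    have i1 := integrable_mul_testFunction l1 hφ.continuous hφc hφs
    have i2 := integrable_mul_testFunction l2 hφ.continuous hφc hφs
    have hz : ∀ F : Rn N → ℂ, ∫ x in Ω, F x * (φ x : ℂ) = ∫ x, F x * (φ x : ℂ) := by
      intro F
      refine setIntegral_eq_integral_of_forall_compl_eq_zero fun x hx => ?_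
      rw [image_eq_zero_of_notMem_tsupport fun h => hx (hφs h)]
      simp
    have e := (hG.2.2 φ hφ hφc hφs i).symm.trans (hG'.2.2 φ hφ hφc hφs i)
    rw [neg_inj, hz fun x => G x i, hz fun x => G' x i] at e
    have : ∀ x, φ x • (G x i - G' x i) = G x i * (φ x : ℂ) - G' x i * (φ x : ℂ) := fun x => by
      rw [Complex.real_smul]
      ring
    simp only [this]
    rw [integral_sub i1 i2, e, sub_self]
  rw [Filter.EventuallyEq, ae_restrict_iff' hΩ.measurableSet]
  filter_upwards [ae_all_iff.2 hi] with x hx hxΩ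
  ext i
  exact sub_eq_zero.1 (hx i hxΩ)

theorem IsLocallyBounded.exists_bound {N : ℕ} {A : Rn N → Rn N} (hA : IsLocallyBounded A)
    {K : Set (Rn N)} (hK : IsCompact K) : ∃ C : ℝ, ∀ x ∈ K, ‖A x‖ ≤ C := by
  refine hK.induction_on (p := fun s => ∃ C : ℝ, ∀ x ∈ s, ‖A x‖ ≤ C) ⟨0, by simp⟩ ?_ ?_ ?_
  · rintro s t hst ⟨C, hC⟩
    exact ⟨C, fun x hx => hC x (hst hx)⟩
  · rintro s t ⟨C, hC⟩ ⟨C', hC'⟩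
    refine ⟨max C C', fun x hx => ?_⟩
    rcases hx with hx | hx
    · exact (hC x hx).trans (le_max_left _ _)
    · exact (hC' x hx).trans (le_max_right _ _)
  · intro x _
    obtain ⟨C, hC⟩ := hA x
    exact ⟨_, mem_nhdsWithin_of_mem_nhds hC, C, fun y hy => hy⟩

/-- As `A` is bounded on `Ω`, the term `iAu` is square integrable and can be added back. -/
theorem memLp_of_magneticGradient {N : ℕ} {Ω : Set (Rn N)} (hΩ : IsOpen Ω)
    {A : Rn N → Rn N} {C : ℝ} (hC : ∀ x ∈ Ω, ‖A x‖ ≤ C) {u : Rn N → ℂ}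
    (hu : MemLp u 2 (volume.restrict Ω)) {G : Rn N → EuclideanSpace ℂ (Fin N)}
    (hGm : AEStronglyMeasurable G (volume.restrict Ω))
    (hG : MemLp (magneticGradient A u G) 2 (volume.restrict Ω)) :
    MemLp G 2 (volume.restrict Ω) := by
  refine (hG.norm.add (hu.norm.const_mul |C|)).mono' hGm ?_
  filter_upwards [ae_restrict_mem hΩ.measurableSet] with x hx
  have h1 : G x = magneticGradient A u G x
      + (Complex.I * u x) • (WithLp.toLp 2 fun i => (A x i : ℂ)) := by
    ext i
    simp [magneticGradient]
    ring
  have h2 : ‖(WithLp.toLp 2 (fun i => (A x i : ℂ)) : EuclideanSpace ℂ (Fin N))‖ = ‖A x‖ := by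
    simp [EuclideanSpace.norm_eq]
  have h3 : ‖G x‖ ≤ ‖magneticGradient A u G x‖ + ‖u x‖ * ‖A x‖ := by
    conv_lhs => rw [h1]
    refine (norm_add_le _ _).trans ?_
    rw [norm_smul, h2]
    simp
  refine h3.trans ?_
  simp only [Pi.add_apply]
  rw [mul_comm]
  gcongr
  exact (hC x hx).trans (le_abs_self C)

/-- Test functions and their derivatives vanish off `Ω`, so values there are irrelevant; general
directions follow by linearity from the coordinate ones. -/
theorem IsWeakGradient.isExtendedWeakGradient {N : ℕ} {Ω : Set (Rn N)}
    {u u' : Rn N → ℂ} {G G' : Rn N → EuclideanSpace ℂ (Fin N)} (hG : IsWeakGradient Ω u G)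
    (hu : u' =ᵐ[volume.restrict Ω] u) (hGG : G' =ᵐ[volume.restrict Ω] G) :
    IsExtendedWeakGradient Ω u' G' := by
  intro φ hφ hφc hφs v
  have hv : v = ∑ i, v i • EuclideanSpace.single i (1 : ℝ) := by
    ext j
    simp [Finset.sum_apply, Pi.single_apply]
  have hd : ∀ x, (fderiv ℝ φ x v : ℂ)
      = ∑ i, (v i : ℂ) * (fderiv ℝ φ x (EuclideanSpace.single i 1) : ℂ) := by
    intro x
    conv_lhs => rw [hv]
    simp [map_sum]
  have hdc : ∀ i : Fin N, Continuous fun x => fderiv ℝ φ x (EuclideanSpace.single i 1) := fun i =>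
    (hφ.continuous_fderiv (by simp)).clm_apply continuous_const
  have hds : ∀ i : Fin N,
      tsupport (fun x => fderiv ℝ φ x (EuclideanSpace.single i 1)) ⊆ tsupport φ := fun i =>
    tsupport_fderiv_apply_subset ℝ _
  have i1 : ∀ i : Fin N, Integrable (fun x =>
      u x * (fderiv ℝ φ x (EuclideanSpace.single i 1) : ℂ)) volume := fun i =>
    integrable_mul_testFunction hG.1 (hdc i) (hφc.mono' ((subset_tsupport _).trans (hds i)))
      ((hds i).trans hφs)
  have i2 : ∀ i : Fin N, Integrable (fun x => G x i * (φ x : ℂ)) volume := fun i =>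
    integrable_mul_testFunction (locallyIntegrableOn_coord hG.2.1 i) hφ.continuous hφc hφs
  have hzero : ∀ x, x ∉ Ω → x ∉ tsupport φ := fun x hx h => hx (hφs h)
  calc ∫ x, u' x * (fderiv ℝ φ x v : ℂ)
      = ∫ x in Ω, u' x * (fderiv ℝ φ x v : ℂ) := by
        refine (setIntegral_eq_integral_of_forall_compl_eq_zero fun x hx => ?_).symm
        have : fderiv ℝ φ x = 0 := by
          by_contra h
          exact hzero x hx (support_fderiv_subset ℝ h)
        simp [this]
    _ = ∫ x in Ω, ∑ i, (v i : ℂ) * (u x * (fderiv ℝ φ x (EuclideanSpace.single i 1) : ℂ)) := by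
        refine integral_congr_ae (hu.mono fun x hx => ?_)
        simp only [hx, hd, Finset.mul_sum]
        exact Finset.sum_congr rfl fun i _ => by ring
    _ = ∑ i, (v i : ℂ) * -∫ x in Ω, G x i * (φ x : ℂ) := by
        rw [integral_finsetSum _ fun i _ => ((i1 i).restrict).const_mul _]
        refine Finset.sum_congr rfl fun i _ => ?_
        rw [integral_const_mul, hG.2.2 φ hφ hφc hφs i]
    _ = -∫ x in Ω, ∑ i, (v i : ℂ) * (G x i * (φ x : ℂ)) := by
        rw [integral_finsetSum _ fun i _ => ((i2 i).restrict).const_mul _, ← Finset.sum_neg_distrib]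
        refine Finset.sum_congr rfl fun i _ => ?_
        rw [integral_const_mul, mul_neg]
    _ = -∫ x in Ω, cdot (G' x) v * (φ x : ℂ) := by
        congr 1
        refine integral_congr_ae (hGG.mono fun x hx => ?_)
        simp only [hx, cdot, Finset.sum_mul]
        exact Finset.sum_congr rfl fun i _ => by ring
    _ = -∫ x, cdot (G' x) v * (φ x : ℂ) := by
        congr 1
        refine setIntegral_eq_integral_of_forall_compl_eq_zero fun x hx => ?_
        rw [image_eq_zero_of_notMem_tsupport (hzero x hx)]
        simp

/-- Functions in the magnetic Sobolev space have representatives extended by zero. -/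
theorem MemMagneticH1.exists_isExtendedPair {N : ℕ} {Ω : Set (Rn N)} (hΩ : IsOpen Ω)
    (hΩb : Bornology.IsBounded Ω) (hΩL : HasLipschitzBoundary Ω) {A : Rn N → Rn N}
    (hAm : AEStronglyMeasurable A volume) (hAb : IsLocallyBounded A)
    (hA : ContinuousOn A (closure Ω)) {u : Rn N → ℂ} (hu : MemMagneticH1 A Ω u)
    {G : Rn N → EuclideanSpace ℂ (Fin N)} (hG : IsWeakGradient Ω u G) :
    ∃ (u' : Rn N → ℂ) (G' : Rn N → EuclideanSpace ℂ (Fin N)) (C : ℝ),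
      IsExtendedPair Ω A u' G' C ∧ u' =ᵐ[volume.restrict Ω] u ∧ G' =ᵐ[volume.restrict Ω] G := by
  obtain ⟨R, hR⟩ := hΩb.subset_closedBall 0
  obtain ⟨C, hC⟩ := hAb.exists_bound (isCompact_closedBall (0 : Rn N) R)
  obtain ⟨hu2, G₁, hG₁, hG₁2⟩ := hu
  have hG₁m : AEStronglyMeasurable G₁ (volume.restrict Ω) := hG₁.2.1.aestronglyMeasurable
  -- Square integrability is known for the gradient `G₁` coming from `hu`; uniqueness of weak
  -- gradients transfers it to `G`.
  have hG2 : MemLp G 2 (volume.restrict Ω) :=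
    (memLp_congr_ae (hG.ae_eq hΩ hG₁)).2
      (memLp_of_magneticGradient hΩ (fun x hx => hC x (hR hx)) hu2 hG₁m hG₁2)
  have hum := hu2.1
  have hGm := hG2.1
  have hΩm := hΩ.measurableSet
  have eu : Ω.indicator (hum.mk u) =ᵐ[volume.restrict Ω] u :=
    (indicator_ae_eq_restrict hΩm).trans hum.ae_eq_mk.symm
  have eG : Ω.indicator (hGm.mk G) =ᵐ[volume.restrict Ω] G :=
    (indicator_ae_eq_restrict hΩm).trans hGm.ae_eq_mk.symm
  refine ⟨Ω.indicator (hum.mk u), Ω.indicator (hGm.mk G), C, ?_, eu, eG⟩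
  refine ⟨hΩ, hΩb, hΩL, hum.stronglyMeasurable_mk.indicator hΩm, ?_,
    fun x hx => indicator_of_notMem hx _, hGm.stronglyMeasurable_mk.indicator hΩm, ?_,
    fun x hx => indicator_of_notMem hx _, hG.isExtendedWeakGradient eu eG, hAm, ?_, ?_⟩
  · exact (memLp_indicator_iff_restrict hΩm).2 ((memLp_congr_ae hum.ae_eq_mk).1 hu2)
  · exact (memLp_indicator_iff_restrict hΩm).2 ((memLp_congr_ae hGm.ae_eq_mk).1 hG2)
  · intro x h hx hxh
    refine hC _ ?_
    have h1 := hR hx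
    have h2 := hR hxh
    -- The midpoint may lie outside `Ω`, so the bound on `A` is taken on a ball containing `Ω`,
    -- which is convex.
    have := (convex_closedBall (0 : Rn N) R) h1 h2 (a := 1 / 2) (b := 1 / 2) (by norm_num)
      (by norm_num) (by norm_num)
    have e : (1 / 2 : ℝ) • x + (1 / 2 : ℝ) • (x + h) = x + (1 / 2 : ℝ) • h := by module
    rwa [e] at this
  · exact ((hΩb.isCompact_closure).uniformContinuousOn_of_continuous hA).mono subset_closure

theorem magneticIntegrand_eq_diffQuot {N : ℕ} {Ω : Set (Rn N)} (A : Rn N → Rn N) (u : Rn N → ℂ)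
    (ρ : ℝ → ℝ) {x y : Rn N} (hx : x ∈ Ω) (hy : y ∈ Ω) :
    magneticIntegrand A u ρ x y = ‖diffQuot Ω A u (y - x) x‖ ^ 2 * ρ ‖y - x‖ := by
  have e1 : x + (1 / 2 : ℝ) • (y - x) = (1 / 2 : ℝ) • (x + y) := by module
  rw [diffQuot, if_pos ⟨hx, by simpa using hy⟩, phase, e1, neg_sub, add_sub_cancel,
    magneticIntegrand, norm_mul, mul_pow, Complex.norm_real, norm_inv, norm_norm, norm_sub_rev x y,
    inv_pow, div_eq_inv_mul]

end MagneticBBM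

/-! ### The limit formula -/

theorem theorem2p5 {N : ℕ} (hN : 1 ≤ N)
    (Ω : Set (MagneticBBM.Rn N)) (hΩ : IsOpen Ω) (hΩb : Bornology.IsBounded Ω)
    (hΩL : MagneticBBM.HasLipschitzBoundary Ω)
    (A : MagneticBBM.Rn N → MagneticBBM.Rn N)
    (hAm : AEStronglyMeasurable A volume) (hAb : MagneticBBM.IsLocallyBounded A)
    (hA : MagneticBBM.IsC2UpToBoundary A Ω)
    (u : MagneticBBM.Rn N → ℂ) (hu : MagneticBBM.MemMagneticH1 A Ω u)
    (gradu : MagneticBBM.Rn N → EuclideanSpace ℂ (Fin N))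
    (hgradu : MagneticBBM.IsWeakGradient Ω u gradu)
    (ρ : ℕ → ℝ → ℝ) (hρ0 : ∀ n r, 0 ≤ r → 0 ≤ ρ n r)
    (hρ1 : ∀ n, Integrable (fun x : MagneticBBM.Rn N => ρ n ‖x‖) volume)
    (hρlim : Tendsto (fun n => ∫ r in Ioi (0 : ℝ), ρ n r * r ^ (N - 1)) atTop (𝓝 1))
    (hρtail : ∀ δ : ℝ, 0 < δ →
      Tendsto (fun n => ∫ r in Ioi δ, ρ n r * r ^ (N - 1)) atTop (𝓝 0))
    (e : MagneticBBM.Rn N) (he : ‖e‖ = 1) :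
    (∀ n, IntegrableOn
      (fun p : MagneticBBM.Rn N × MagneticBBM.Rn N =>
        MagneticBBM.magneticIntegrand A u (ρ n) p.1 p.2) (Ω ×ˢ Ω) volume) ∧
    Tendsto
      (fun n => ∫ x in Ω, ∫ y in Ω, MagneticBBM.magneticIntegrand A u (ρ n) x y) atTop
      (𝓝 (2 * MagneticBBM.bbmConstant e *
        ∫ x in Ω, ‖MagneticBBM.magneticGradient A u gradu x‖ ^ 2)) := by
  obtain ⟨u', G', C, H, eu, eG⟩ := hu.exists_isExtendedPair hΩ hΩb hΩL hAm hAb hA.2.1 hgradu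
  obtain ⟨hint, hlim⟩ := H.tendsto_integral_diffQuot hN hρ0 hρ1 hρlim hρtail he
  have hΩm := hΩ.measurableSet
  set F : ℕ → MagneticBBM.Rn N × MagneticBBM.Rn N → ℝ := fun n p =>
    ‖MagneticBBM.diffQuot Ω A u' p.1 p.2‖ ^ 2 * ρ n ‖p.1‖ with hF
  -- The change of variables `(x, y) ↦ (h, x)` with `h = y - x` is a swap followed by a shear, hence
  -- preserves the product measure.
  set T : MagneticBBM.Rn N × MagneticBBM.Rn N → MagneticBBM.Rn N × MagneticBBM.Rn N :=
    fun p => (p.2 - p.1, p.1) with hT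
  have hTmp : MeasurePreserving T (volume.prod volume) (volume.prod volume) :=
    (measurePreserving_sub_prod volume volume).comp Measure.measurePreserving_swap
  have hFT : ∀ n, Integrable (F n ∘ T) (volume.prod volume) := fun n =>
    hTmp.integrable_comp_of_integrable (hint n)
  have hFTint : ∀ n, ∫ p, F n (T p) ∂(volume.prod volume) = ∫ p, F n p ∂(volume.prod volume) := by
    intro n
    conv_rhs => rw [← hTmp.map_eq]
    rw [integral_map hTmp.aemeasurable]
    rw [hTmp.map_eq]
    exact (hint n).1
  have hae : ∀ n, (fun p : MagneticBBM.Rn N × MagneticBBM.Rn N =>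
      MagneticBBM.magneticIntegrand A u (ρ n) p.1 p.2)
      =ᵐ[(volume.restrict Ω).prod (volume.restrict Ω)] F n ∘ T := by
    intro n
    have h1 := (Measure.quasiMeasurePreserving_fst (μ := volume.restrict Ω)
      (ν := volume.restrict Ω)).ae (eu.and (ae_restrict_mem hΩm))
    have h2 := (Measure.quasiMeasurePreserving_snd (μ := volume.restrict Ω)
      (ν := volume.restrict Ω)).ae (eu.and (ae_restrict_mem hΩm))
    filter_upwards [h1, h2] with p hp1 hp2
    simp only [hF, hT, Function.comp_apply]
    rw [← MagneticBBM.magneticIntegrand_eq_diffQuot A u' (ρ n) hp1.2 hp2.2,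
      MagneticBBM.magneticIntegrand, MagneticBBM.magneticIntegrand, hp1.1, hp2.1]
  have hres : ((volume : Measure (MagneticBBM.Rn N)).prod volume).restrict (Ω ×ˢ Ω)
      = (volume.restrict Ω).prod (volume.restrict Ω) := (Measure.prod_restrict Ω Ω).symm
  have hΦ : ∀ n, Integrable (fun p : MagneticBBM.Rn N × MagneticBBM.Rn N =>
      MagneticBBM.magneticIntegrand A u (ρ n) p.1 p.2)
      ((volume.restrict Ω).prod (volume.restrict Ω)) := by
    intro n
    rw [integrable_congr (hae n), ← hres]
    exact (hFT n).restrict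
  refine ⟨fun n => ?_, ?_⟩
  · rw [IntegrableOn, Measure.volume_eq_prod, hres]
    exact hΦ n
  · have hgrad : ∫ x in Ω, ‖MagneticBBM.magneticGradient A u gradu x‖ ^ 2
        = ∫ x, ‖MagneticBBM.magneticGradient A u' G' x‖ ^ 2 := by
      have hzero : ∀ x, x ∉ Ω → ‖MagneticBBM.magneticGradient A u' G' x‖ ^ 2 = 0 := fun x hx => by
        rw [H.magneticGradient_eq_zero hx]
        simp
      rw [← setIntegral_eq_integral_of_forall_compl_eq_zero hzero]
      refine integral_congr_ae ?_
      filter_upwards [eu, eG] with x h1 h2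
      simp only [MagneticBBM.magneticGradient, h1, h2]
    rw [hgrad]
    refine hlim.congr fun n => ?_
    rw [← hFTint n, ← integral_prod _ (hΦ n), integral_congr_ae (hae n), ← hres]
    -- The difference quotient vanishes unless both endpoints lie in `Ω`, so the integral over `Ω ×ˢ
    -- Ω` is the integral over the whole product.
    refine (setIntegral_eq_integral_of_forall_compl_eq_zero fun p hp => ?_).symm
    have : ¬(p.1 ∈ Ω ∧ p.1 + (p.2 - p.1) ∈ Ω) := by
      rw [add_sub_cancel]
      exact hp
    simp [hF, hT, MagneticBBM.diffQuot, mem_prod.not.1 hp]
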